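/- **Setting.** Let $G=(V,E,w)$ be a connected, simple, undirected graph with $n$ vertices and $m$ edges that is unweighted, i.e. $w(e)=1$ for all $e\in E$. Let $d(u,v)$ be the shortest-path distance, $\hat d(u,v)$ the least number of edges on a shortest path from $u$ to $v$, $B(u,x)=\{v\mid d(u,v)\le x\}$, and $\bar r_k(u)=\min_{v:\hat d(u,v)>k} d(u,v)$ the $k$-radius of $u$ ($\infty$ if there is no such $v$). Write $\log=\log_2$, and let $\log^* x$ be the number of times $\log_2$ must be applied to $x$ until the result is at most $1$. *Radius Stepping* with source $s\in V$ and radii $r:V\to[0,\infty]$ is the following algorithm. Initially $\delta(s)=0$, $\delta(v)=w(s,v)$ for the neighbours $v$ of $s$, $\delta(v)=\infty$ otherwise, and $S_0=\{s\}$. In step $i=1,2,\dots$, as long as $S_{i-1}\ne V$, set $d_i=\min_{v\in V\setminus S_{i-1}}(\delta(v)+r(v))$; then repeat the substep "for all $u\in V\setminus S_{i-1}$ with $\delta(u)\le d_i$ and all $v\in N(u)\setminus S_{i-1}$ in parallel, $\delta(v)\leftarrow\min\{\delta(v),\delta(u)+w(u,v)\}$" until a substep changes no $\delta(v)\le d_i$;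 then set $S_i=\{v\mid\delta(v)\le d_i\}$. The machine is a synchronous CRCW PRAM with concurrent reads and priority-writes (the least of the values written simultaneously to a cell is stored); work is the total number of operations and depth is the length of the longest sequence of dependent operations. The graph is given by adjacency arrays. **Lemma.** There are a CRCW PRAM program and a constant $C$ such that the following holds for all integers $k\ge 1$ and $\rho\ge 2$, every unweighted graph $G$ as above, every source $s\in V$ and all radii $r$ that satisfy $$r(v)\le\bar r_k(v)\quad\text{and}\quad |B(v,r(v))|\ge\rho\qquad\text{for all }v\in V.$$ On input $(G,s,r)$ the program executes Radius Stepping (that is, Radius Stepping terminates, and the program produces, step by step, the round distance $d_i$ and the tentative distances $\delta$ at the end of step $i$), and it terminates with $\delta(v)=d(s,v)$ for all $v\in V$, using work at most $C(m+n)$ and depth at most $$C\,k\,\frac n\rho\,\log\rho\,\log^*\rho .$$ In particular, for $k=1$ (or any constant $k$), Radius Stepping computes single-source shortest paths on unweighted graphs in $O(m+n)$ work and $O((n/\rho)\log\rho\log^*\rho)$ depth. -/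

import Mathlib

open scoped ENNReal NNReal

/-! ## Distances, hop distances, balls and `k`-radii in weighted undirected graphs -/

namespace RadiusStepping

variable {V : Type*}

/-- The total weight of a walk. -/
noncomputable def walkWeight (G : SimpleGraph V) (w : Sym2 V → ℝ≥0) {u v : V}
    (p : G.Walk u v) : ℝ≥0∞ :=
  (p.edges.map (fun e => (w e : ℝ≥0∞))).sum

/-- The shortest-path distance `d(u,v)` (`∞` if there is no path). -/
noncomputable def wdist (G : SimpleGraph V) (w : Sym2 V → ℝ≥0) (u v : V) : ℝ≥0∞ :=
  ⨅ p : G.Walk u v, walkWeight G w p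

/-- The hop distance: the least number of edges of a shortest (weighted) path from `u` to `v`. -/
noncomputable def hopDist (G : SimpleGraph V) (w : Sym2 V → ℝ≥0) (u v : V) : ℕ∞ :=
  ⨅ (p : G.Walk u v) (_ : walkWeight G w p = wdist G w u v), (p.length : ℕ∞)

/-- The `k`-radius of `u`: the least distance from `u` to a vertex that is more than `k` hops away
(`∞` if there is no such vertex). -/
noncomputable def kRadius (G : SimpleGraph V) (w : Sym2 V → ℝ≥0) (k : ℕ) (u : V) : ℝ≥0∞ :=
  ⨅ (v : V) (_ : (k : ℕ∞) < hopDist G w u v), wdist G w u v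

/-- The enclosed ball `B(u,x)`. -/
def ball (G : SimpleGraph V) (w : Sym2 V → ℝ≥0) (u : V) (x : ℝ≥0∞) : Set V :=
  {v | wdist G w u v ≤ x}

/-! ## The Radius-Stepping algorithm

The algorithm is given by its tentative distances `δ` and its visited sets `S`.  It sets
`δ(src) = 0`, `δ(v) = w(src,v)` for the neighbours `v` of `src`, `δ = ∞` elsewhere, and `S = {src}`.
While `S ≠ V` it performs a step: it computes the round distance `d`, performs substeps until no
tentative distance `≤ d` was changed by the last substep, and sets `S = {v | δ(v) ≤ d}`. -/

open Classical in
/-- The initial tentative distances. -/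
noncomputable def initDelta (G : SimpleGraph V) (w : Sym2 V → ℝ≥0) (src : V) : V → ℝ≥0∞ :=
  fun v => if v = src then 0 else if G.Adj src v then (w s(src, v) : ℝ≥0∞) else ∞

/-- The round distance: the minimum of `δ(v) + r(v)` over the unvisited vertices. -/
noncomputable def roundDist (r : V → ℝ≥0∞) (S : Set V) (δ : V → ℝ≥0∞) : ℝ≥0∞ :=
  ⨅ (v : V) (_ : v ∉ S), δ v + r v

open Classical in
/-- One substep: in parallel, all unvisited `u` with `δ(u) ≤ d` relax the edges to their unvisited
neighbours. -/
noncomputable def substep (G : SimpleGraph V) (w : Sym2 V → ℝ≥0) (S : Set V) (d : ℝ≥0∞)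
    (δ : V → ℝ≥0∞) : V → ℝ≥0∞ :=
  fun v => if v ∈ S then δ v else
    min (δ v) (⨅ (u : V) (_ : u ∉ S ∧ δ u ≤ d ∧ G.Adj u v), δ u + (w s(u, v) : ℝ≥0∞))

/-- `Substeps G w S d δ δ'`: the repeat-until loop of a step, entered with tentative distances `δ`,
ends with tentative distances `δ'`. -/
inductive Substeps (G : SimpleGraph V) (w : Sym2 V → ℝ≥0) (S : Set V) (d : ℝ≥0∞) :
    (V → ℝ≥0∞) → (V → ℝ≥0∞) → Prop
  | last (δ : V → ℝ≥0∞)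
      (h : ∀ v, substep G w S d δ v ≤ d → substep G w S d δ v = δ v) :
      Substeps G w S d δ (substep G w S d δ)
  | again (δ δ' : V → ℝ≥0∞)
      (h : ∃ v, substep G w S d δ v ≤ d ∧ substep G w S d δ v ≠ δ v)
      (hs : Substeps G w S d (substep G w S d δ) δ') :
      Substeps G w S d δ δ'

/-- `Steps G w r δ S tr`: the while loop, entered with tentative distances `δ` and visited set `S`,
terminates, and `tr` lists, for each of its steps, the round distance and the tentative distances at
the end of the step. -/
inductive Steps (G : SimpleGraph V) (w : Sym2 V → ℝ≥0) (r : V → ℝ≥0∞) :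
    (V → ℝ≥0∞) → Set V → List (ℝ≥0∞ × (V → ℝ≥0∞)) → Prop
  | done (δ : V → ℝ≥0∞) : Steps G w r δ Set.univ []
  | step (δ δ' : V → ℝ≥0∞) (S : Set V) (tr : List (ℝ≥0∞ × (V → ℝ≥0∞)))
      (hS : S ≠ Set.univ)
      (hd : Substeps G w S (roundDist r S δ) δ δ')
      (ht : Steps G w r δ' {v | δ' v ≤ roundDist r S δ} tr) :
      Steps G w r δ S ((roundDist r S δ, δ') :: tr)

/-- `tr` is the sequence of round distances and tentative distances of the (terminating) run of the
Radius-Stepping algorithm from the source `src` with the vertex radii `r`. -/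
def IsRun (G : SimpleGraph V) (w : Sym2 V → ℝ≥0) (r : V → ℝ≥0∞) (src : V)
    (tr : List (ℝ≥0∞ × (V → ℝ≥0∞))) : Prop :=
  Steps G w r (initDelta G w src) {src} tr

end RadiusStepping

/-! ## A CRCW PRAM with work and depth

Shared memory consists of arrays of natural numbers and of arrays of distances (extended nonnegative
reals).  Distances can only be added and compared.  A program is built from parallel assignments
`for q < p pardo if c(q) then A[i(q)] := x(q)`, sequencing, branching and while loops.  A parallel
assignment is synchronous: all reads precede all writes.  Concurrent reads are allowed, and
concurrent writes to one cell are resolved by priority-write: the least of the written values is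
stored.  Every operation costs one unit; work counts the operations of all the parallel
instances, depth counts the longest sequence of dependent operations. -/

namespace PRAM

/-- Shared memory: cell `j` of the number array `a` is `num a j`, cell `j` of the distance array `a`
is `dst a j`. -/
structure State where
  num : ℕ → ℕ → ℕ
  dst : ℕ → ℕ → ℝ≥0∞

mutual
/-- Expressions with a natural number as value; `pid` is the index of the evaluating instance, `sub`
is truncated, `half` rounds down, comparisons yield `1` or `0`. -/
inductive NumExpr where
  | const (c : ℕ)
  | pid
  | get (a : ℕ) (i : NumExpr)
  | add (x y : NumExpr)
  | sub (x y : NumExpr)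
  | half (x : NumExpr)
  | lt (x y : NumExpr)
  | dstLt (x y : DstExpr)
/-- Expressions with a distance as value. -/
inductive DstExpr where
  | inf
  | ofNum (x : NumExpr)
  | get (a : ℕ) (i : NumExpr)
  | add (x y : DstExpr)
end

mutual
/-- The value of a number expression for the instance `q`. -/
noncomputable def NumExpr.eval (σ : State) (q : ℕ) : NumExpr → ℕ
  | .const c => c
  | .pid => q
  | .get a i => σ.num a (i.eval σ q)
  | .add x y => x.eval σ q + y.eval σ q
  | .sub x y => x.eval σ q - y.eval σ q
  | .half x => x.eval σ q / 2
  | .lt x y => if x.eval σ q < y.eval σ q then 1 else 0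
  | .dstLt x y => if x.eval σ q < y.eval σ q then 1 else 0
/-- The value of a distance expression for the instance `q`. -/
noncomputable def DstExpr.eval (σ : State) (q : ℕ) : DstExpr → ℝ≥0∞
  | .inf => ∞
  | .ofNum x => (x.eval σ q : ℝ≥0∞)
  | .get a i => σ.dst a (i.eval σ q)
  | .add x y => x.eval σ q + y.eval σ q
end

mutual
/-- The number of operations needed to evaluate a number expression. -/
def NumExpr.cost : NumExpr → ℕ
  | .const _ => 1
  | .pid => 1
  | .get _ i => i.cost + 1
  | .add x y => x.cost + y.cost + 1
  | .sub x y => x.cost + y.cost + 1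
  | .half x => x.cost + 1
  | .lt x y => x.cost + y.cost + 1
  | .dstLt x y => x.cost + y.cost + 1
/-- The number of operations needed to evaluate a distance expression. -/
def DstExpr.cost : DstExpr → ℕ
  | .inf => 1
  | .ofNum x => x.cost + 1
  | .get _ i => i.cost + 1
  | .add x y => x.cost + y.cost + 1
end

/-- Programs.  `setNum p c a i x` is `for q < p pardo if c(q) ≠ 0 then num a [i(q)] := x(q)`, and
`setDst` is the same for distance arrays.  `mark` has no effect and no cost; it only lists the
current state in the trace of the execution. -/
inductive Program where
  | skip
  | mark
  | setNum (p c : NumExpr) (a : ℕ) (i x : NumExpr)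
  | setDst (p c : NumExpr) (a : ℕ) (i : NumExpr) (x : DstExpr)
  | seq (P Q : Program)
  | ite (c : NumExpr) (P Q : Program)
  | loop (c : NumExpr) (P : Program)

open Classical in
/-- The contents of an array with contents `old` after those of the instances `q < p` that satisfy
`act` have simultaneously written `x q` to cell `i q`: the least written value is stored. -/
noncomputable def priorityWrite {α : Type*} [InfSet α] (p : ℕ) (act : ℕ → Prop) (i : ℕ → ℕ)
    (x : ℕ → α) (old : ℕ → α) : ℕ → α :=
  fun j => if ∃ q < p, act q ∧ i q = j then sInf {y | ∃ q < p, act q ∧ i q = j ∧ x q = y}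
    else old j

/-- The effect of the parallel assignment `setNum`. -/
noncomputable def State.setNum (σ : State) (p c : NumExpr) (a : ℕ) (i x : NumExpr) : State where
  num := Function.update σ.num a
    (priorityWrite (p.eval σ 0) (fun q => c.eval σ q ≠ 0) (fun q => i.eval σ q)
      (fun q => x.eval σ q) (σ.num a))
  dst := σ.dst

/-- The effect of the parallel assignment `setDst`. -/
noncomputable def State.setDst (σ : State) (p c : NumExpr) (a : ℕ) (i : NumExpr) (x : DstExpr) :
    State where
  num := σ.num
  dst := Function.update σ.dst a
    (priorityWrite (p.eval σ 0) (fun q => c.eval σ q ≠ 0) (fun q => i.eval σ q)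
      (fun q => x.eval σ q) (σ.dst a))

/-- `Exec P σ σ' tr W D`: started in `σ`, the program `P` terminates in `σ'` after work `W` and
depth `D`, and `tr` lists the states at the executed marks, in order. -/
inductive Exec : Program → State → State → List State → ℕ → ℕ → Prop
  | skip (σ : State) : Exec .skip σ σ [] 0 0
  | mark (σ : State) : Exec .mark σ σ [σ] 0 0
  | setNum (σ : State) (p c : NumExpr) (a : ℕ) (i x : NumExpr) :
      Exec (.setNum p c a i x) σ (σ.setNum p c a i x) []
        (p.cost + 1 + p.eval σ 0 * (c.cost + i.cost + x.cost + 1))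
        (p.cost + 1 + (c.cost + i.cost + x.cost + 1))
  | setDst (σ : State) (p c : NumExpr) (a : ℕ) (i : NumExpr) (x : DstExpr) :
      Exec (.setDst p c a i x) σ (σ.setDst p c a i x) []
        (p.cost + 1 + p.eval σ 0 * (c.cost + i.cost + x.cost + 1))
        (p.cost + 1 + (c.cost + i.cost + x.cost + 1))
  | seq {P Q : Program} {σ σ₁ σ₂ : State} {tr₁ tr₂ : List State} {W₁ W₂ D₁ D₂ : ℕ}
      (hP : Exec P σ σ₁ tr₁ W₁ D₁) (hQ : Exec Q σ₁ σ₂ tr₂ W₂ D₂) :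
      Exec (.seq P Q) σ σ₂ (tr₁ ++ tr₂) (W₁ + W₂) (D₁ + D₂)
  | iteTrue {c : NumExpr} {P Q : Program} {σ σ' : State} {tr : List State} {W D : ℕ}
      (hc : c.eval σ 0 ≠ 0) (hP : Exec P σ σ' tr W D) :
      Exec (.ite c P Q) σ σ' tr (c.cost + 1 + W) (c.cost + 1 + D)
  | iteFalse {c : NumExpr} {P Q : Program} {σ σ' : State} {tr : List State} {W D : ℕ}
      (hc : c.eval σ 0 = 0) (hQ : Exec Q σ σ' tr W D) :
      Exec (.ite c P Q) σ σ' tr (c.cost + 1 + W) (c.cost + 1 + D)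
  | loopTrue {c : NumExpr} {P : Program} {σ σ₁ σ₂ : State} {tr₁ tr₂ : List State}
      {W₁ W₂ D₁ D₂ : ℕ}
      (hc : c.eval σ 0 ≠ 0) (hP : Exec P σ σ₁ tr₁ W₁ D₁)
      (hL : Exec (.loop c P) σ₁ σ₂ tr₂ W₂ D₂) :
      Exec (.loop c P) σ σ₂ (tr₁ ++ tr₂) (c.cost + 1 + (W₁ + W₂)) (c.cost + 1 + (D₁ + D₂))
  | loopFalse {c : NumExpr} {P : Program} {σ : State} (hc : c.eval σ 0 = 0) :
      Exec (.loop c P) σ σ [] (c.cost + 1) (c.cost + 1)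

/-- The initial memory for the input consisting of the unweighted graph `G` on the vertices
`0, …, n - 1`, the source `src` and the radii `r`.  Number array `0` holds `n` and `src`; number
arrays `1` and `2` hold `G` in adjacency-array format: array `2` lists the neighbours of `v`, in any
order, in its cells `num 1 v ≤ j < num 1 (v + 1)`.  Distance array `0` holds the radii.  All other
cells are zero. -/
structure IsInput {n : ℕ} (G : SimpleGraph (Fin n)) (src : Fin n) (r : Fin n → ℝ≥0∞)
    (σ : State) : Prop where
  size : σ.num 0 0 = n
  source : σ.num 0 1 = src
  offset_zero : σ.num 1 0 = 0
  offset_succ : ∀ v : Fin n, σ.num 1 ((v : ℕ) + 1) = σ.num 1 v + (G.neighborSet v).ncard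
  neighbors : ∀ v : Fin n, Set.BijOn (σ.num 2) (Set.Ico (σ.num 1 v) (σ.num 1 ((v : ℕ) + 1)))
    ((fun u : Fin n => (u : ℕ)) '' G.neighborSet v)
  radii : ∀ v : Fin n, σ.dst 0 v = r v
  num_zero : ∀ j, 2 ≤ j → σ.num 0 j = 0
  num_one : ∀ j, n < j → σ.num 1 j = 0
  num_two : ∀ j, σ.num 1 n ≤ j → σ.num 2 j = 0
  num_rest : ∀ a j, 3 ≤ a → σ.num a j = 0
  dst_zero : ∀ j, n ≤ j → σ.dst 0 j = 0
  dst_rest : ∀ a j, 1 ≤ a → σ.dst a j = 0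

/-- Where the results are kept: distance array `1` holds the tentative distances `δ`. -/
def State.delta (σ : State) (n : ℕ) : Fin n → ℝ≥0∞ := fun v => σ.dst 1 v

/-- Where the results are kept: the first cell of distance array `2` holds the round distance. -/
def State.round (σ : State) : ℝ≥0∞ := σ.dst 2 0

end PRAM

/-- The iterated logarithm: how often `log₂` has to be applied to `x` until the result is at
most `1`. -/
noncomputable def logStar (x : ℝ) : ℕ := sInf {t : ℕ | (Real.logb 2)^[t] x ≤ 1}

namespace RadiusStepping

-- Unweighted distances; substeps as breadth-first levels

section Unweighted

variable {V : Type*} {G : SimpleGraph V} {w : Sym2 V → ℝ≥0}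

-- On an unweighted graph Radius Stepping is breadth-first search in disguise. Let `levelDelta G s
-- t` be the distances from the source, replaced by ∞ beyond level t. The initial tentative
-- distances are those for t = 1, and a substep leads from t to t + 1 as long as the round distance
-- d is at least t (`substep_levelDelta`). A step ends when d < t + 1 or level t + 1 is empty; its
-- visited set is then the set of vertices at distance less than t + 1, so the next step starts in
-- the same kind of situation. The radii only decide how levels are grouped into steps, and a
-- program that expands level after level and compares the level number with d reproduces the run
-- (`exec_levelLoop`).
--
-- To expand a level, the program lists the heads of all arcs that leave it, with repetitions. Marks
-- single out one occurrence of each new vertex, so the list is never compacted. Prefix sums allot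
-- one instance to each arc, prefix maxima tell the instance its tail, and priority-writes select
-- first occurrences. If a_t arcs leave level t, this takes O(a_{t-1} + a_t + 1) work and O(log
-- a_{t-1} + log a_t + 1) depth (`exec_expand`). The a_t sum to 2m and there are at most n levels,
-- whence the work bound.
--
-- For the depth, each ball B(v, r(v)) lies within k + 1 hops of v, so a vertex of any level has ρ
-- vertices in the levels at most k + 1 away; double counting leaves at most (2k + 3)n/ρ levels
-- (`levelCount_mul_le`). Moreover a_t ≤ b_t², where b_t counts the vertices of levels t - 1, t, t +
-- 1, and log b_t ≤ log ρ + 2b_t/ρ. As the b_t sum to at most 3n, levels much larger than ρ add only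
-- O(n/ρ) (`sum_log_arcCount_le`). This construction produces no log* factor; only log* ρ ≥ 1 is
-- used.

theorem walkWeight_eq_length (hw : ∀ e ∈ G.edgeSet, w e = 1) {u v : V} (p : G.Walk u v) :
    walkWeight G w p = p.length := by
  unfold walkWeight
  rw [List.map_congr_left (g := fun _ => (1 : ℝ≥0∞))]
  · simp
  · intro e he
    simp [hw e (p.edges_subset_edgeSet he)]

theorem wdist_eq_dist (hG : G.Connected) (hw : ∀ e ∈ G.edgeSet, w e = 1) (u v : V) :
    wdist G w u v = G.dist u v := by
  unfold wdist
  simp only [walkWeight_eq_length hw]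
  apply le_antisymm
  · obtain ⟨p, hp⟩ := hG.exists_walk_length_eq_dist u v
    exact (iInf_le _ p).trans (by rw [hp])
  · exact le_iInf fun p => by exact_mod_cast G.dist_le p

theorem hopDist_eq_dist (hG : G.Connected) (hw : ∀ e ∈ G.edgeSet, w e = 1) (u v : V) :
    hopDist G w u v = G.dist u v := by
  unfold hopDist
  simp only [walkWeight_eq_length hw, wdist_eq_dist hG hw]
  apply le_antisymm
  · obtain ⟨p, hp⟩ := hG.exists_walk_length_eq_dist u v
    exact (iInf₂_le p (by rw [hp])).trans (by rw [hp])
  · exact le_iInf₂ fun p _ => by exact_mod_cast G.dist_le p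

/-- A vertex at positive distance has a neighbour that is closer by one. -/
theorem exists_adj_dist_eq (hG : G.Connected) {s v : V} {t : ℕ} (h : G.dist s v = t + 1) :
    ∃ u, G.Adj u v ∧ G.dist s u = t := by
  obtain ⟨p, hp⟩ := hG.exists_walk_length_eq_dist v s
  rw [SimpleGraph.dist_comm, h] at hp
  cases p with
  | nil => simp at hp
  | @cons _ u _ ha q =>
    refine ⟨u, ha.symm, ?_⟩
    rw [SimpleGraph.Walk.length_cons] at hp
    have h1 := G.dist_le q
    have h2 := hG.dist_triangle (u := s) (v := u) (w := v)
    rw [SimpleGraph.dist_eq_one_iff_adj.2 ha.symm] at h2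
    rw [SimpleGraph.dist_comm] at h1
    omega

theorem exists_dist_eq_of_le (hG : G.Connected) {s v : V} {t : ℕ} (h : t ≤ G.dist s v) :
    ∃ u, G.dist s u = t := by
  generalize hd : G.dist s v = d at h
  induction d generalizing v with
  | zero => exact ⟨v, by omega⟩
  | succ d ih =>
    rcases h.eq_or_lt with rfl | h
    · exact ⟨v, hd⟩
    · obtain ⟨u, -, hu⟩ := exists_adj_dist_eq hG hd
      exact ih hu (by omega)

theorem dist_le_succ_of_adj (hG : G.Connected) {s u v : V} (h : G.Adj u v) :
    G.dist s v ≤ G.dist s u + 1 := by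
  have := hG.dist_triangle (u := s) (v := u) (w := v)
  rwa [SimpleGraph.dist_eq_one_iff_adj.2 h] at this

/-- If some vertex is more than k + 1 hops away, then some vertex is exactly k + 1 hops away, and it
bounds the k-radius by k + 1. The closed ball may attain this value, hence k + 1 and not k. -/
theorem dist_le_of_mem_ball (hG : G.Connected) (hw : ∀ e ∈ G.edgeSet, w e = 1) {k : ℕ}
    {v x : V} {a : ℝ≥0∞} (ha : a ≤ kRadius G w k v) (hx : x ∈ ball G w v a) :
    G.dist v x ≤ k + 1 := by
  by_contra! h
  obtain ⟨y, hy⟩ := exists_dist_eq_of_le hG h.le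
  have h1 : kRadius G w k v ≤ ((k + 1 : ℕ) : ℝ≥0∞) := by
    refine (iInf₂_le y ?_).trans ?_
    · rw [hopDist_eq_dist hG hw, hy]
      exact_mod_cast Nat.lt_succ_self k
    · rw [wdist_eq_dist hG hw, hy]
  have h2 : wdist G w v x ≤ a := hx
  rw [wdist_eq_dist hG hw] at h2
  have h3 : ((G.dist v x : ℕ) : ℝ≥0∞) ≤ ((k + 1 : ℕ) : ℝ≥0∞) := h2.trans (ha.trans h1)
  have : G.dist v x ≤ k + 1 := by exact_mod_cast h3
  omega

variable (G) in
open Classical in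
/-- The distances from `s` truncated after level `t`. -/
noncomputable def levelDelta (s : V) (t : ℕ) (v : V) : ℝ≥0∞ :=
  if G.dist s v ≤ t then (G.dist s v : ℝ≥0∞) else ∞

theorem levelDelta_of_le {s v : V} {t : ℕ} (h : G.dist s v ≤ t) :
    levelDelta G s t v = G.dist s v := if_pos h

theorem levelDelta_of_lt {s v : V} {t : ℕ} (h : t < G.dist s v) :
    levelDelta G s t v = ∞ := if_neg (by omega)

theorem dist_le_levelDelta (s v : V) (t : ℕ) : (G.dist s v : ℝ≥0∞) ≤ levelDelta G s t v := by
  unfold levelDelta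
  split_ifs <;> simp

theorem lt_levelDelta_iff {s v : V} {t : ℕ} : (t : ℝ≥0∞) < levelDelta G s t v ↔ t < G.dist s v := by
  unfold levelDelta
  split_ifs with h
  · simp
  · simp at h; simp [h]

theorem initDelta_eq_levelDelta (hG : G.Connected) (hw : ∀ e ∈ G.edgeSet, w e = 1) (s : V) :
    initDelta G w s = levelDelta G s 1 := by
  funext v
  unfold initDelta
  split_ifs with h1 h2
  · subst h1
    rw [levelDelta_of_le (by simp)]
    simp
  · have h3 := SimpleGraph.dist_eq_one_iff_adj.2 h2
    rw [levelDelta_of_le h3.le, h3, hw _ h2]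
    simp
  · rw [levelDelta_of_lt]
    have h3 : G.dist s v ≠ 0 := by
      rw [Ne, hG.dist_eq_zero_iff]
      exact fun h => h1 h.symm
    have h4 : G.dist s v ≠ 1 := by rwa [Ne, SimpleGraph.dist_eq_one_iff_adj]
    omega

/-- Level t is unvisited because t₀ ≤ t, and active because t ≤ d. Vertices beyond it still have δ =
∞ and contribute nothing even if d = ∞, so exactly level t + 1 gets its value. -/
theorem substep_levelDelta (hG : G.Connected) (hw : ∀ e ∈ G.edgeSet, w e = 1) (s : V)
    {t₀ t : ℕ} {d : ℝ≥0∞} (h₀ : t₀ ≤ t) (hd : (t : ℝ≥0∞) ≤ d) :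
    substep G w {v | G.dist s v < t₀} d (levelDelta G s t) = levelDelta G s (t + 1) := by
  have key : ∀ v, levelDelta G s (t + 1) v ≤
      ⨅ (u : V) (_ : u ∉ {v | G.dist s v < t₀} ∧ levelDelta G s t u ≤ d ∧ G.Adj u v),
        levelDelta G s t u + (w s(u, v) : ℝ≥0∞) := by
    intro v
    refine le_iInf₂ fun u hu => ?_
    rw [hw _ hu.2.2]
    have h1 := dist_le_succ_of_adj hG (s := s) hu.2.2
    by_cases h2 : G.dist s u ≤ t
    · rw [levelDelta_of_le h2, levelDelta_of_le (by omega)]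
      exact_mod_cast h1
    · rw [levelDelta_of_lt (by omega : t < G.dist s u)]
      simp
  funext v
  unfold substep
  split_ifs with h
  · have h' : G.dist s v < t₀ := h
    rw [levelDelta_of_le (by omega), levelDelta_of_le (by omega)]
  · by_cases h1 : G.dist s v ≤ t
    · rw [min_eq_left, levelDelta_of_le h1, levelDelta_of_le (by omega)]
      refine le_trans (le_of_eq ?_) (key v)
      rw [levelDelta_of_le h1, levelDelta_of_le (by omega)]
    · rw [levelDelta_of_lt (by omega : t < G.dist s v), min_eq_right le_top]
      refine le_antisymm ?_ (key v)
      by_cases h2 : G.dist s v = t + 1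
      · obtain ⟨u, hu, hut⟩ := exists_adj_dist_eq hG h2
        have hu₀ : u ∉ {v | G.dist s v < t₀} := by
          rw [Set.mem_ofPred_eq]
          omega
        have hud : levelDelta G s t u ≤ d := by
          rwa [levelDelta_of_le hut.le, hut]
        refine (iInf₂_le u ⟨hu₀, hud, hu⟩).trans ?_
        · rw [levelDelta_of_le hut.le, hut, hw _ hu, levelDelta_of_le h2.le, h2]
          simp
      · rw [levelDelta_of_lt (by omega : t + 1 < G.dist s v)]
        exact le_top

/-- Unvisited vertices beyond level t have δ = ∞, so the minimum can be taken over the current level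
alone, which is all that the program inspects. -/
theorem roundDist_levelDelta (r : V → ℝ≥0∞) (s : V) (t : ℕ) :
    roundDist r {v | G.dist s v < t} (levelDelta G s t) =
      ⨅ (v : V) (_ : G.dist s v = t), levelDelta G s t v + r v := by
  unfold roundDist
  apply le_antisymm
  · exact le_iInf₂ fun v hv => iInf₂_le v (by simp [hv])
  · refine le_iInf₂ fun v hv => ?_
    have hv' : t ≤ G.dist s v := by simpa using hv
    rcases hv'.eq_or_lt with h | h
    · exact iInf₂_le v h.symm
    · rw [levelDelta_of_lt h]
      simp

theorem le_roundDist_levelDelta (r : V → ℝ≥0∞) (s : V) (t : ℕ) :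
    (t : ℝ≥0∞) ≤ roundDist r {v | G.dist s v < t} (levelDelta G s t) := by
  rw [roundDist_levelDelta]
  refine le_iInf₂ fun v hv => ?_
  rw [levelDelta_of_le hv.le, hv]
  exact le_self_add

end Unweighted

end RadiusStepping

namespace RadiusStepping

-- Counting levels, arcs and nearby vertices

section Levels

variable {V : Type*} [Fintype V] {G : SimpleGraph V}

variable (G) in
/-- The number of nonempty distance levels from `s`. -/
noncomputable def levelCount (s : V) : ℕ := Finset.univ.sup (G.dist s) + 1

variable (G) in
open Classical in
/-- The number of arcs that leave the distance level `t` from `s`. -/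
noncomputable def arcCount (s : V) (t : ℕ) : ℕ :=
  ∑ v with G.dist s v = t, (G.neighborSet v).ncard

variable (G) in
open Classical in
/-- The number of vertices in the distance levels `t - 1`, `t` and `t + 1` from `s`. -/
noncomputable def nearCount (s : V) (t : ℕ) : ℕ :=
  Finset.card {v : V | G.dist s v ≤ t + 1 ∧ t ≤ G.dist s v + 1}

theorem dist_lt_levelCount (s v : V) : G.dist s v < levelCount G s :=
  Nat.lt_succ_of_le (Finset.le_sup (f := G.dist s) (Finset.mem_univ v))

theorem lt_levelCount_iff (hG : G.Connected) (s : V) (t : ℕ) :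
    t < levelCount G s ↔ ∃ v, G.dist s v = t := by
  constructor
  · intro h
    obtain ⟨v, -, hv⟩ := Finset.exists_mem_eq_sup Finset.univ ⟨s, Finset.mem_univ s⟩ (G.dist s)
    refine exists_dist_eq_of_le hG (v := v) ?_
    rw [← hv]
    exact Nat.le_of_lt_succ h
  · rintro ⟨v, rfl⟩
    exact dist_lt_levelCount s v

open Classical in
theorem sum_range_arcCount (s : V) :
    ∑ t ∈ Finset.range (levelCount G s), arcCount G s t = 2 * G.edgeSet.ncard := by
  unfold arcCount
  rw [Finset.sum_fiberwise_of_maps_to (fun v _ => Finset.mem_range.2 (dist_lt_levelCount s v)),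
    ← SimpleGraph.coe_edgeFinset, Set.ncard_coe_finset, ← G.sum_degrees_eq_twice_card_edges]
  refine Finset.sum_congr rfl fun v _ => ?_
  exact Set.ncard_eq_toFinset_card' _

/-- If every vertex has at least `ρ` vertices within distance `R`, then the number of levels is
at most `(2 * R + 1) * n / ρ`. -/
theorem levelCount_mul_le (hG : G.Connected) (s : V) {R ρ : ℕ}
    (h : ∀ v, ρ ≤ {x | G.dist v x ≤ R}.ncard) :
    levelCount G s * ρ ≤ (2 * R + 1) * Fintype.card V := by
  classical
  -- Double counting of pairs of a level and a vertex at most R levels away: each level has at least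
  -- ρ partners, namely the vertices within distance R of one of its vertices; each vertex has at
  -- most 2R + 1.
  have key := Finset.card_mul_le_card_mul (s := Finset.range (levelCount G s))
    (t := (Finset.univ : Finset V)) (fun l x => G.dist s x ≤ l + R ∧ l ≤ G.dist s x + R)
    (m := ρ) (n := 2 * R + 1) ?_ ?_
  · rwa [Finset.card_range, Finset.card_univ, mul_comm (Fintype.card V)] at key
  · intro l hl
    obtain ⟨v, rfl⟩ := (lt_levelCount_iff hG s l).1 (Finset.mem_range.1 hl)
    refine (h v).trans ?_
    rw [← Set.ncard_coe_finset]
    refine Set.ncard_le_ncard ?_ (Set.toFinite _)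
    intro x hx
    have h0 : G.dist v x ≤ R := hx
    have h1 := hG.dist_triangle (u := s) (v := v) (w := x)
    have h2 := hG.dist_triangle (u := s) (v := x) (w := v)
    rw [G.dist_comm (u := x)] at h2
    simp only [Finset.coe_bipartiteAbove, Finset.mem_univ, true_and, Set.mem_ofPred_eq]
    omega
  · intro x _
    refine (Finset.card_le_card (t := Finset.Icc (G.dist s x - R) (G.dist s x + R)) ?_).trans ?_
    · intro l hl
      simp only [Finset.bipartiteBelow, Finset.mem_filter, Finset.mem_Icc] at hl ⊢
      omega
    · rw [Nat.card_Icc]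
      omega

theorem levelCount_le_card (hG : G.Connected) (s : V) : levelCount G s ≤ Fintype.card V := by
  have := levelCount_mul_le hG s (R := 0) (ρ := 1) fun v => by
    rw [Nat.succ_le_iff, Set.ncard_pos (Set.toFinite _)]
    exact ⟨v, by simp⟩
  omega

open Classical in
theorem sum_range_nearCount_le (s : V) (L : ℕ) :
    ∑ t ∈ Finset.range L, nearCount G s t ≤ 3 * Fintype.card V := by
  have := Finset.sum_card_bipartiteAbove_eq_sum_card_bipartiteBelow (s := Finset.range L)
    (t := (Finset.univ : Finset V)) (fun t v => G.dist s v ≤ t + 1 ∧ t ≤ G.dist s v + 1)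
  unfold nearCount
  unfold Finset.bipartiteAbove at this
  rw [this, mul_comm, ← Finset.card_univ, ← smul_eq_mul]
  refine Finset.sum_le_card_nsmul _ _ _ fun v _ => ?_
  refine (Finset.card_le_card (t := Finset.Icc (G.dist s v - 1) (G.dist s v + 1)) ?_).trans ?_
  · intro l hl
    simp only [Finset.bipartiteBelow, Finset.mem_filter, Finset.mem_Icc] at hl ⊢
    omega
  · rw [Nat.card_Icc]
    omega

open Classical in
-- Adjacent vertices differ by at most one level, so tails and heads of these arcs are all among the
-- nearby vertices.
theorem arcCount_le_nearCount_sq (hG : G.Connected) (s : V) (t : ℕ) :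
    arcCount G s t ≤ nearCount G s t * nearCount G s t := by
  unfold arcCount
  refine (Finset.sum_le_card_nsmul _ _ (nearCount G s t) fun v hv => ?_).trans ?_
  · unfold nearCount
    rw [← Set.ncard_coe_finset]
    refine Set.ncard_le_ncard ?_ (Set.toFinite _)
    intro u hu
    have hv' : G.dist s v = t := by simpa using hv
    have hu' : G.Adj v u := hu
    have h1 := dist_le_succ_of_adj hG (s := s) hu'
    have h2 := dist_le_succ_of_adj hG (s := s) hu'.symm
    simp only [Finset.coe_filter, Finset.mem_univ, true_and, Set.mem_ofPred_eq]
    omega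
  · rw [smul_eq_mul]
    refine Nat.mul_le_mul_right _ (Finset.card_le_card ?_)
    intro v hv
    simp only [Finset.mem_filter, Finset.mem_univ, true_and] at hv ⊢
    omega

theorem logb_two_le_two_mul {x : ℝ} (hx : 0 < x) : Real.logb 2 x ≤ 2 * x := by
  rw [Real.logb, div_le_iff₀ (Real.log_pos one_lt_two)]
  have h1 := Real.log_le_sub_one_of_pos hx
  have h2 := Real.log_two_gt_d9
  nlinarith

/-- Writing b = ρ · (b/ρ) and bounding log(b/ρ) linearly separates a term log ρ per level from a
term b/ρ that can be summed over the levels. -/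
theorem log_arcCount_le (hG : G.Connected) (s : V) (t : ℕ) {ρ : ℕ} (hρ : 1 ≤ ρ) :
    (Nat.log 2 (arcCount G s t) : ℝ) ≤ 2 * Real.logb 2 ρ + 4 * (nearCount G s t / ρ) := by
  have hρ' : (1 : ℝ) ≤ ρ := by exact_mod_cast hρ
  have hlog : 0 ≤ Real.logb 2 ρ := Real.logb_nonneg one_lt_two hρ'
  rcases Nat.eq_zero_or_pos (arcCount G s t) with h0 | h0
  · rw [h0]
    simp only [Nat.log_zero_right, Nat.cast_zero]
    positivity
  have h1 := arcCount_le_nearCount_sq hG s t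
  have h2 : 0 < nearCount G s t := Nat.pos_of_ne_zero fun h => by rw [h] at h1; omega
  have h2' : (0 : ℝ) < nearCount G s t := by exact_mod_cast h2
  have h3 : (arcCount G s t : ℝ) ≤ nearCount G s t * nearCount G s t := by exact_mod_cast h1
  have h4 : Real.logb 2 (arcCount G s t) ≤ Real.logb 2 (nearCount G s t * nearCount G s t) :=
    Real.logb_le_logb_of_le one_lt_two (by exact_mod_cast h0) h3
  have h5 : Real.logb 2 (nearCount G s t / ρ) ≤ 2 * (nearCount G s t / ρ) :=
    logb_two_le_two_mul (by positivity)
  rw [Real.logb_mul h2'.ne' h2'.ne'] at h4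
  rw [Real.logb_div h2'.ne' (by positivity)] at h5
  have h6 := Real.natLog_le_logb (arcCount G s t) 2
  push_cast at h6
  linarith

end Levels

/-- The iteration has to be shown to reach 1 at all, because the infimum of an empty set of naturals
is 0. -/
theorem logStar_pos {ρ : ℕ} (hρ : 2 ≤ ρ) : 1 ≤ logStar ρ := by
  have key : ∀ (m : ℕ) (x : ℝ), x ≤ m + 1 → ∃ t, (Real.logb 2)^[t] x ≤ 1 := by
    intro m
    induction m with
    | zero => exact fun x hx => ⟨0, by simpa using hx⟩
    | succ m ih =>
      intro x hx
      rcases le_or_gt x 1 with h | h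
      · exact ⟨0, h⟩
      push_cast at hx
      have : Real.logb 2 x ≤ m + 1 := by
        rw [Real.logb_le_iff_le_rpow one_lt_two (by linarith)]
        -- Bernoulli: m + 2 ≤ 2^(m+1), so one logarithm lowers the bound m + 2 to m + 1.
        have h1 := one_add_mul_self_le_rpow_one_add (s := 1) (by norm_num) (p := m + 1)
          (by linarith [(Nat.cast_nonneg m : (0 : ℝ) ≤ m)])
        norm_num at h1
        linarith
      obtain ⟨t, ht⟩ := ih _ this
      exact ⟨t + 1, ht⟩
  have hne : {t : ℕ | (Real.logb 2)^[t] (ρ : ℝ) ≤ 1}.Nonempty := key ρ ρ (by linarith)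
  have hmem := Nat.sInf_mem hne
  by_contra h
  have h0 : logStar ρ = 0 := by omega
  unfold logStar at h0
  rw [h0] at hmem
  have : (ρ : ℝ) ≤ 1 := hmem
  have : ρ ≤ 1 := by exact_mod_cast this
  omega

end RadiusStepping

namespace PRAM

-- Effects and costs of the basic parallel assignments

theorem Exec.seq_nil {P Q : Program} {σ σ₁ σ₂ : State} {W₁ W₂ D₁ D₂ : ℕ}
    (hP : Exec P σ σ₁ [] W₁ D₁) (hQ : Exec Q σ₁ σ₂ [] W₂ D₂) :
    Exec (.seq P Q) σ σ₂ [] (W₁ + W₂) (D₁ + D₂) := .seq hP hQ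

theorem Exec.cast {P : Program} {σ σ' : State} {tr : List State} {W W' D D' : ℕ}
    (h : Exec P σ σ' tr W D) (hW : W = W') (hD : D = D') : Exec P σ σ' tr W' D' := hW ▸ hD ▸ h

section PriorityWrite

variable {p : ℕ} {act : ℕ → Prop} {i : ℕ → ℕ} {j : ℕ}

theorem priorityWrite_of_forall_ne {α : Type*} [InfSet α] {x old : ℕ → α}
    (h : ∀ q < p, act q → i q ≠ j) : priorityWrite p act i x old j = old j :=
  if_neg fun ⟨q, hq, ha, hi⟩ => h q hq ha hi

theorem priorityWrite_of_forall_eq {α : Type*} [ConditionallyCompleteLattice α] {x old : ℕ → α}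
    {q : ℕ} (hq : q < p) (ha : act q) (hi : i q = j)
    (h : ∀ q' < p, act q' → i q' = j → x q' = x q) : priorityWrite p act i x old j = x q := by
  unfold priorityWrite
  rw [if_pos ⟨q, hq, ha, hi⟩]
  convert csInf_singleton (x q) using 2
  ext y
  constructor
  · rintro ⟨q', h1, h2, h3, rfl⟩
    exact h q' h1 h2 h3
  · rintro rfl
    exact ⟨q, hq, ha, hi, rfl⟩

theorem priorityWrite_of_injOn {α : Type*} [ConditionallyCompleteLattice α] {x old : ℕ → α}
    {q : ℕ} (hq : q < p) (ha : act q)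
    (h : ∀ q' < p, act q' → i q' = i q → q' = q) : priorityWrite p act i x old (i q) = x q :=
  priorityWrite_of_forall_eq hq ha rfl fun q' h1 h2 h3 => by rw [h q' h1 h2 h3]

theorem priorityWrite_le {x old : ℕ → ℕ} {q : ℕ} (hq : q < p) (ha : act q) (hi : i q = j) :
    priorityWrite p act i x old j ≤ x q := by
  unfold priorityWrite
  rw [if_pos ⟨q, hq, ha, hi⟩]
  exact Nat.sInf_le ⟨q, hq, ha, hi, rfl⟩

theorem exists_priorityWrite_eq {x old : ℕ → ℕ} {q : ℕ} (hq : q < p) (ha : act q) (hi : i q = j) :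
    ∃ q' < p, act q' ∧ i q' = j ∧ priorityWrite p act i x old j = x q' := by
  unfold priorityWrite
  rw [if_pos ⟨q, hq, ha, hi⟩]
  have hne : {y | ∃ q < p, act q ∧ i q = j ∧ x q = y}.Nonempty := ⟨x q, q, hq, ha, hi, rfl⟩
  obtain ⟨q', h1, h2, h3, h4⟩ := Nat.sInf_mem hne
  exact ⟨q', h1, h2, h3, h4.symm⟩

end PriorityWrite

theorem exec_setNum (σ : State) (p c : NumExpr) (a : ℕ) (i x : NumExpr) :
    ∃ σ', Exec (.setNum p c a i x) σ σ' []
        (p.cost + 1 + p.eval σ 0 * (c.cost + i.cost + x.cost + 1))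
        (p.cost + 1 + (c.cost + i.cost + x.cost + 1)) ∧
      σ'.num a = priorityWrite (p.eval σ 0) (fun q => c.eval σ q ≠ 0) (fun q => i.eval σ q)
        (fun q => x.eval σ q) (σ.num a) ∧
      (∀ b ≠ a, σ'.num b = σ.num b) ∧ σ'.dst = σ.dst :=
  ⟨_, .setNum σ p c a i x, Function.update_self .., fun _ hb => Function.update_of_ne hb ..,
    rfl⟩

theorem exec_setDst (σ : State) (p c : NumExpr) (a : ℕ) (i : NumExpr) (x : DstExpr) :
    ∃ σ', Exec (.setDst p c a i x) σ σ' []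
        (p.cost + 1 + p.eval σ 0 * (c.cost + i.cost + x.cost + 1))
        (p.cost + 1 + (c.cost + i.cost + x.cost + 1)) ∧
      σ'.dst a = priorityWrite (p.eval σ 0) (fun q => c.eval σ q ≠ 0) (fun q => i.eval σ q)
        (fun q => x.eval σ q) (σ.dst a) ∧
      (∀ b ≠ a, σ'.dst b = σ.dst b) ∧ σ'.num = σ.num :=
  ⟨_, .setDst σ p c a i x, Function.update_self .., fun _ hb => Function.update_of_ne hb ..,
    rfl⟩

/-- `for q < p pardo A[q] := x(q)`. -/
def fill (p : NumExpr) (a : ℕ) (x : NumExpr) : Program :=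
  .setNum p (.const 1) a .pid x

/-- `for q < p pardo if c(q) then A[q] := x(q)`. -/
def fillIf (p c : NumExpr) (a : ℕ) (x : NumExpr) : Program :=
  .setNum p c a .pid x

/-- The scalar assignment `A[0] := x`. -/
def assign (a : ℕ) (x : NumExpr) : Program :=
  .setNum (.const 1) (.const 1) a (.const 0) x

/-- The scalar kept in cell `0` of the array `a`. -/
def NumExpr.var (a : ℕ) : NumExpr := .get a (.const 0)

@[simp] theorem NumExpr.eval_var (σ : State) (q a : ℕ) :
    (NumExpr.var a).eval σ q = σ.num a 0 := by simp [NumExpr.var, NumExpr.eval]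

@[simp] theorem NumExpr.cost_var (a : ℕ) : (NumExpr.var a).cost = 2 := by
  simp [NumExpr.var, NumExpr.cost]

theorem exec_fillIf (σ : State) (p c : NumExpr) (a : ℕ) (x : NumExpr) :
    ∃ σ', Exec (fillIf p c a x) σ σ' []
        (p.cost + 1 + p.eval σ 0 * (c.cost + x.cost + 2)) (p.cost + c.cost + x.cost + 3) ∧
      (∀ j, σ'.num a j =
        if j < p.eval σ 0 ∧ c.eval σ j ≠ 0 then x.eval σ j else σ.num a j) ∧
      (∀ b ≠ a, σ'.num b = σ.num b) ∧ σ'.dst = σ.dst := by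
  obtain ⟨σ', h, h1, h2⟩ := exec_setNum σ p c a .pid x
  refine ⟨σ', h.cast ?_ ?_, fun j => ?_, h2⟩
  · simp only [NumExpr.cost]; ring
  · simp only [NumExpr.cost]; ring
  rw [h1]
  split_ifs with hj
  · exact priorityWrite_of_injOn (i := fun q => NumExpr.pid.eval σ q) (q := j) hj.1 hj.2
      (by simp [NumExpr.eval])
  · refine priorityWrite_of_forall_ne ?_
    rintro q hq hc rfl
    exact hj ⟨hq, hc⟩

theorem exec_fill (σ : State) (p : NumExpr) (a : ℕ) (x : NumExpr) :
    ∃ σ', Exec (fill p a x) σ σ' []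
        (p.cost + 1 + p.eval σ 0 * (x.cost + 3)) (p.cost + x.cost + 4) ∧
      (∀ j, σ'.num a j = if j < p.eval σ 0 then x.eval σ j else σ.num a j) ∧
      (∀ b ≠ a, σ'.num b = σ.num b) ∧ σ'.dst = σ.dst := by
  obtain ⟨σ', h, h1, h2⟩ := exec_fillIf σ p (.const 1) a x
  refine ⟨σ', h.cast ?_ ?_, fun j => ?_, h2⟩
  · simp only [NumExpr.cost]; ring
  · simp only [NumExpr.cost]; ring
  rw [h1]
  simp [NumExpr.eval]

theorem exec_assign (σ : State) (a : ℕ) (x : NumExpr) :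
    ∃ σ', Exec (assign a x) σ σ' [] (x.cost + 5) (x.cost + 5) ∧
      σ'.num a 0 = x.eval σ 0 ∧ (∀ b ≠ a, σ'.num b = σ.num b) ∧ σ'.dst = σ.dst := by
  obtain ⟨σ', h, h1, h2⟩ := exec_setNum σ (.const 1) (.const 1) a (.const 0) x
  refine ⟨σ', h.cast ?_ ?_, ?_, h2⟩
  · simp only [NumExpr.cost, NumExpr.eval]; ring
  · simp only [NumExpr.cost]; ring
  rw [h1]
  exact priorityWrite_of_injOn (i := fun q => (NumExpr.const 0).eval σ q) (q := 0)
    (by simp [NumExpr.eval]) (by simp [NumExpr.eval]) (by simp [NumExpr.eval])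

/-! ### Prefix folds by up- and down-sweeps -/

/-- The exclusive prefix folds of a sequence. -/
def prefixFold (f : ℕ → ℕ → ℕ) (x : ℕ → ℕ) : ℕ → ℕ
  | 0 => 0
  | i + 1 => f (prefixFold f x i) (x i)

/-- Level `l` of the up-sweep tree: folds of consecutive blocks of length `2 ^ l`. -/
def upSweep (f : ℕ → ℕ → ℕ) (x : ℕ → ℕ) : ℕ → ℕ → ℕ
  | 0, q => x q
  | l + 1, q => f (upSweep f x l (2 * q)) (upSweep f x l (2 * q + 1))

/-- Merging blocks in pairs does not change a prefix fold. Only associativity is needed; the seed 0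
need not be neutral. -/
theorem prefixFold_upSweep_succ {f : ℕ → ℕ → ℕ} (hf : ∀ a b c, f (f a b) c = f a (f b c))
    (x : ℕ → ℕ) (l q : ℕ) :
    prefixFold f (upSweep f x (l + 1)) q = prefixFold f (upSweep f x l) (2 * q) := by
  induction q with
  | zero => rfl
  | succ q ih =>
    rw [prefixFold, ih, Nat.mul_succ, prefixFold, prefixFold, hf]
    rfl

theorem prefixFold_congr (f : ℕ → ℕ → ℕ) {x y : ℕ → ℕ} {i : ℕ} (h : ∀ j < i, x j = y j) :
    prefixFold f x i = prefixFold f y i := by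
  induction i with
  | zero => rfl
  | succ i ih =>
    rw [prefixFold, prefixFold, ih fun j hj => h j (hj.trans i.lt_succ_self), h i i.lt_succ_self]

/-- Sets `P` (scalar `13`) to a power of two above `N` (scalar `11`). -/
def findPow : Program :=
  .seq (assign 13 (.const 1))
    (.loop (.lt (.var 13) (.add (.var 11) (.const 1))) (assign 13 (.add (.var 13) (.var 13))))

/-- `d` is fuel: each doubling adds at least 1 to the power. The bound 2 ^ a ≤ 2 * N is carried
along so that the tree stays linear in N. -/
theorem exec_findPow_loop (d : ℕ) : ∀ (σ : State) (N a : ℕ), σ.num 11 0 = N →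
    σ.num 13 0 = 2 ^ a → (a = 0 ∨ 2 ^ a ≤ 2 * N) → N + 1 ≤ 2 ^ a + d →
    ∃ σ' W h, Exec (.loop (.lt (.var 13) (.add (.var 11) (.const 1)))
        (assign 13 (.add (.var 13) (.var 13)))) σ σ' [] W W ∧
      σ'.num 13 0 = 2 ^ h ∧ N < 2 ^ h ∧ (h = 0 ∨ 2 ^ h ≤ 2 * N) ∧ a ≤ h ∧
      W ≤ 18 * (h - a) + 8 ∧
      (∀ b ≠ 13, σ'.num b = σ.num b) ∧ σ'.dst = σ.dst := by
  induction d with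
  | zero =>
    intro σ N a hN ha h1 h2
    refine ⟨σ, _, a, .loopFalse ?_, ha, by omega, h1, le_rfl, ?_, fun _ _ => rfl, rfl⟩
    · simp [NumExpr.eval, hN, ha]; omega
    · simp [NumExpr.cost]
  | succ d ih =>
    intro σ N a hN ha h1 h2
    by_cases hlt : N < 2 ^ a
    · exact (ih σ N a hN ha h1 (by omega))
    · obtain ⟨σ₁, e₁, v₁, f₁, g₁⟩ := exec_assign σ 13 (.add (.var 13) (.var 13))
      simp only [NumExpr.eval, NumExpr.eval_var, ha] at v₁
      have := Nat.one_le_two_pow (n := a)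
      obtain ⟨σ', W, h, e, hv, hNh, hh, hah, hW, f, g⟩ := ih σ₁ N (a + 1)
        (by rw [f₁ _ (by decide), hN]) (by rw [v₁, pow_succ]; ring) (by rw [pow_succ]; omega)
        (by rw [pow_succ]; omega)
      refine ⟨σ', _, h, .loopTrue ?_ e₁ e, hv, hNh, hh, by omega, ?_,
        fun b hb => by rw [f b hb, f₁ b hb], by rw [g, g₁]⟩
      · simp [NumExpr.eval, hN, ha]; omega
      · simp only [NumExpr.cost, NumExpr.cost_var]
        omega

theorem exec_findPow (σ : State) (N : ℕ) (hN : σ.num 11 0 = N) :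
    ∃ σ' W h, Exec findPow σ σ' [] W W ∧ σ'.num 13 0 = 2 ^ h ∧ N < 2 ^ h ∧
      (h = 0 ∨ 2 ^ h ≤ 2 * N) ∧ W ≤ 18 * h + 14 ∧
      (∀ b ≠ 13, σ'.num b = σ.num b) ∧ σ'.dst = σ.dst := by
  obtain ⟨σ₁, e₁, v₁, f₁, g₁⟩ := exec_assign σ 13 (.const 1)
  obtain ⟨σ', W, h, e, hv, hNh, hh, hah, hW, f, g⟩ := exec_findPow_loop N σ₁ N 0
    (by rw [f₁ _ (by decide), hN]) (by simpa [NumExpr.eval] using v₁) (.inl rfl) (by omega)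
  refine ⟨σ', _, h, e₁.seq_nil e, hv, hNh, hh, ?_, fun b hb => by rw [f b hb, f₁ b hb],
    by rw [g, g₁]⟩
  simp only [NumExpr.cost]
  omega

end PRAM

namespace PRAM

/-- `for q < p pardo A[i(q)] := x(q)`. -/
def scatter (p : NumExpr) (a : ℕ) (i x : NumExpr) : Program :=
  .setNum p (.const 1) a i x

theorem exec_scatter (σ : State) (p : NumExpr) (a : ℕ) (i x : NumExpr)
    (hinj : ∀ q q', i.eval σ q' = i.eval σ q → q' = q) :
    ∃ σ', Exec (scatter p a i x) σ σ' []
        (p.cost + 1 + p.eval σ 0 * (i.cost + x.cost + 2)) (p.cost + i.cost + x.cost + 3) ∧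
      (∀ q < p.eval σ 0, σ'.num a (i.eval σ q) = x.eval σ q) ∧
      (∀ j, (∀ q < p.eval σ 0, i.eval σ q ≠ j) → σ'.num a j = σ.num a j) ∧
      (∀ b ≠ a, σ'.num b = σ.num b) ∧ σ'.dst = σ.dst := by
  obtain ⟨σ', h, h1, h2⟩ := exec_setNum σ p (.const 1) a i x
  refine ⟨σ', h.cast ?_ ?_, fun q hq => ?_, fun j hj => ?_, h2⟩
  · simp only [NumExpr.cost]; ring
  · simp only [NumExpr.cost]; ring
  · rw [h1]
    exact priorityWrite_of_injOn (i := fun q => i.eval σ q) hq (by simp [NumExpr.eval])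
      fun q' _ _ h => hinj _ _ h
  · rw [h1]
    exact priorityWrite_of_forall_ne fun q hq _ => hj q hq

/-- The tree node that is treated by an instance: the width of the level is scalar `14`. -/
def node : NumExpr := .add (.var 14) .pid

/-- The left child of the node that is treated by an instance. -/
def leftChild : NumExpr := .add node node

/-- The right child of the node that is treated by an instance. -/
def rightChild : NumExpr := .add leftChild (.const 1)

theorem eval_node (σ : State) (q : ℕ) : node.eval σ q = σ.num 14 0 + q := by
  simp [node, NumExpr.eval]

theorem eval_leftChild (σ : State) (q : ℕ) :
    leftChild.eval σ q = 2 * σ.num 14 0 + 2 * q := by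
  simp only [leftChild, NumExpr.eval, eval_node]; ring

theorem eval_rightChild (σ : State) (q : ℕ) :
    rightChild.eval σ q = 2 * σ.num 14 0 + (2 * q + 1) := by
  simp only [rightChild, NumExpr.eval, eval_leftChild]; ring

theorem cost_node : node.cost = 4 := by simp [node, NumExpr.cost]

theorem cost_leftChild : leftChild.cost = 9 := by simp [leftChild, NumExpr.cost, cost_node]

theorem cost_rightChild : rightChild.cost = 11 := by
  simp [rightChild, NumExpr.cost, cost_leftChild]

/-- The up-sweep of a tree (array `15`) with `P` (scalar `13`) leaves. -/
def upLoop (op : NumExpr → NumExpr → NumExpr) : Program :=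
  .loop (.lt (.const 1) (.var 14)) (.seq (assign 14 (.half (.var 14)))
    (scatter (.var 14) 15 node (op (.get 15 leftChild) (.get 15 rightChild))))

/-- The down-sweep of a tree (array `16`), using the tree of the up-sweep (array `15`). -/
def downLoop (op : NumExpr → NumExpr → NumExpr) : Program :=
  .loop (.lt (.var 14) (.var 13))
    (.seq (scatter (.var 14) 16 leftChild (.get 16 node))
      (.seq (scatter (.var 14) 16 rightChild (op (.get 16 node) (.get 15 leftChild)))
        (assign 14 (.add (.var 14) (.var 14)))))

/-- Prefix folds: the first `N` (scalar `11`) cells of array `10` are folded by `op` into the first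
`N + 1` cells of array `12`. -/
def scan (op : NumExpr → NumExpr → NumExpr) : Program :=
  .seq findPow
    (.seq (scatter (.var 11) 15 (.add (.var 13) .pid) (.get 10 .pid))
      (.seq (assign 14 (.var 13))
        (.seq (upLoop op)
          (.seq (scatter (.const 1) 16 (.add (.const 1) .pid) (.const 0))
            (.seq (downLoop op)
              (fill (.add (.var 11) (.const 1)) 12 (.get 16 (.add (.var 13) .pid))))))))

/-- The expression operation `op` computes `f` at a bounded overhead. -/
structure Computes (op : NumExpr → NumExpr → NumExpr) (f : ℕ → ℕ → ℕ) : Prop where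
  eval : ∀ x y σ q, (op x y).eval σ q = f (x.eval σ q) (y.eval σ q)
  cost : ∀ x y, (op x y).cost ≤ 2 * x.cost + y.cost + 2

variable {op : NumExpr → NumExpr → NumExpr} {f : ℕ → ℕ → ℕ}

/-- The tree is numbered like a heap: cell 2 ^ j + q is node q among the 2 ^ j nodes of its level,
and cell c has children 2c and 2c + 1. The work is a geometric sum over the levels. -/
theorem exec_upLoop (hop : Computes op f) (x : ℕ → ℕ) (h l : ℕ) : ∀ (σ : State), l ≤ h →
    σ.num 14 0 = 2 ^ l →
    (∀ j ≤ h, l ≤ j → ∀ q < 2 ^ j, σ.num 15 (2 ^ j + q) = upSweep f x (h - j) q) →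
    ∃ σ' W D, Exec (upLoop op) σ σ' [] W D ∧ W ≤ 80 * 2 ^ l ∧ D ≤ 80 * (l + 1) ∧
      σ'.num 14 0 = 1 ∧
      (∀ j ≤ h, ∀ q < 2 ^ j, σ'.num 15 (2 ^ j + q) = upSweep f x (h - j) q) ∧
      (∀ b, b ≠ 14 → b ≠ 15 → σ'.num b = σ.num b) ∧ σ'.dst = σ.dst := by
  induction l with
  | zero =>
    intro σ hl h14 hx
    refine ⟨σ, _, _, .loopFalse ?_, ?_, ?_, by simpa using h14, fun j hj => hx j hj (by omega),
      fun _ _ _ => rfl, rfl⟩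
    · simp [NumExpr.eval, h14]
    · simp [NumExpr.cost]
    · simp [NumExpr.cost]
  | succ l ih =>
    intro σ hl h14 hx
    obtain ⟨σ₁, e₁, v₁, f₁, g₁⟩ := exec_assign σ 14 (.half (.var 14))
    have hv : σ₁.num 14 0 = 2 ^ l := by
      rw [v₁]; simp only [NumExpr.eval, NumExpr.eval_var, h14, pow_succ]; omega
    obtain ⟨σ₂, e₂, v₂, u₂, f₂, g₂⟩ := exec_scatter σ₁ (.var 14) 15 node
      (op (.get 15 leftChild) (.get 15 rightChild)) (fun q q' => by simp only [eval_node]; omega)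
    simp only [eval_node, hop.eval, NumExpr.eval, eval_leftChild, eval_rightChild,
      NumExpr.eval_var, hv, f₁ 15 (by decide), ← pow_succ'] at v₂ u₂ e₂
    have hx₂ : ∀ j ≤ h, l ≤ j → ∀ q < 2 ^ j, σ₂.num 15 (2 ^ j + q) = upSweep f x (h - j) q := by
      intro j hj hlj q hq
      rcases hlj.eq_or_lt with rfl | hlj
      · rw [v₂ q hq, hx (l + 1) hl le_rfl _ (by rw [pow_succ]; omega),
          hx (l + 1) hl le_rfl _ (by rw [pow_succ]; omega),
          show h - l = h - (l + 1) + 1 by omega]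
        rfl
      · rw [u₂, hx j hj hlj q hq]
        intro q' hq'
        have := Nat.pow_le_pow_right (n := 2) (by decide) hlj
        rw [Nat.succ_eq_add_one, pow_succ] at this
        omega
    obtain ⟨σ', W, D, e, hW, hD, h1, h2, h3, h4⟩ := ih σ₂ (by omega)
      (by rw [f₂ _ (by decide), hv]) hx₂
    · refine ⟨σ', _, _, .loopTrue ?_ (e₁.seq_nil e₂) e, ?_, ?_, h1, h2,
        fun b hb hb' => by rw [h3 b hb hb', f₂ b hb', f₁ b hb], by rw [h4, g₂, g₁]⟩
      · have := Nat.one_le_two_pow (n := l)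
        simp [NumExpr.eval, h14]
      · have := hop.cost (.get 15 leftChild) (.get 15 rightChild)
        simp only [NumExpr.cost, NumExpr.cost_var, cost_node, cost_leftChild,
          cost_rightChild] at this ⊢
        have h2 := Nat.mul_le_mul_left (2 ^ l) this
        have := Nat.one_le_two_pow (n := l)
        simp only [mul_add, pow_succ] at h2 ⊢
        omega
      · have := hop.cost (.get 15 leftChild) (.get 15 rightChild)
        simp only [NumExpr.cost, NumExpr.cost_var, cost_node, cost_leftChild,
          cost_rightChild] at this ⊢
        omega

/-- Each node receives the fold of everything to its left: a left child inherits it from its parent,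
a right child appends the block of its left sibling. The summand 90 * 2 ^ l makes the work bound
telescope as the levels double. -/
theorem exec_downLoop (hop : Computes op f) (hf : ∀ a b c, f (f a b) c = f a (f b c)) (x : ℕ → ℕ)
    (h d : ℕ) : ∀ (l : ℕ) (σ : State), l + d = h →
    σ.num 13 0 = 2 ^ h → σ.num 14 0 = 2 ^ l →
    (∀ j ≤ h, ∀ q < 2 ^ j, σ.num 15 (2 ^ j + q) = upSweep f x (h - j) q) →
    (∀ q < 2 ^ l, σ.num 16 (2 ^ l + q) = prefixFold f (upSweep f x (h - l)) q) →
    ∃ σ' W D, Exec (downLoop op) σ σ' [] W D ∧ W + 90 * 2 ^ l ≤ 90 * 2 ^ h + 6 ∧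
      D ≤ 90 * (d + 1) ∧
      (∀ q < 2 ^ h, σ'.num 16 (2 ^ h + q) = prefixFold f x q) ∧
      (∀ b, b ≠ 14 → b ≠ 16 → σ'.num b = σ.num b) ∧ σ'.dst = σ.dst := by
  induction d with
  | zero =>
    intro l σ hl h13 h14 hx hy
    obtain rfl : l = h := hl
    refine ⟨σ, _, _, .loopFalse ?_, ?_, ?_, fun q hq => ?_, fun _ _ _ => rfl, rfl⟩
    · simp [NumExpr.eval, h14, h13]
    · simp [NumExpr.cost]; omega
    · simp [NumExpr.cost]
    · rw [hy q hq, Nat.sub_self]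
      exact prefixFold_congr _ fun _ _ => rfl
  | succ d ih =>
    intro l σ hl h13 h14 hx hy
    obtain ⟨σ₁, e₁, v₁, u₁, f₁, g₁⟩ := exec_scatter σ (.var 14) 16 leftChild (.get 16 node)
      (fun q q' => by simp only [eval_leftChild]; omega)
    simp only [eval_node, NumExpr.eval, eval_leftChild, NumExpr.eval_var, h14, ← pow_succ']
      at v₁ u₁ e₁
    have h14' : σ₁.num 14 0 = 2 ^ l := by rw [f₁ _ (by decide), h14]
    obtain ⟨σ₂, e₂, v₂, u₂, f₂, g₂⟩ := exec_scatter σ₁ (.var 14) 16 rightChild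
      (op (.get 16 node) (.get 15 leftChild)) (fun q q' => by simp only [eval_rightChild]; omega)
    simp only [eval_node, hop.eval, NumExpr.eval, eval_leftChild, eval_rightChild,
      NumExpr.eval_var, h14', f₁ 15 (by decide), ← pow_succ'] at v₂ u₂ e₂
    obtain ⟨σ₃, e₃, v₃, f₃, g₃⟩ := exec_assign σ₂ 14 (.add (.var 14) (.var 14))
    simp only [NumExpr.eval, NumExpr.eval_var, f₂ 14 (by decide), h14'] at v₃
    have hpos := Nat.one_le_two_pow (n := l)
    have hstep : h - l = h - (l + 1) + 1 := by omega
    have hy₃ : ∀ q < 2 ^ (l + 1),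
        σ₃.num 16 (2 ^ (l + 1) + q) = prefixFold f (upSweep f x (h - (l + 1))) q := by
      intro q hq
      rw [f₃ _ (by decide)]
      rw [pow_succ] at hq
      obtain ⟨q', rfl | rfl⟩ := Nat.even_or_odd' q
      · rw [u₂ _ (fun q hq => by omega), v₁ q' (by omega), hy q' (by omega), hstep,
          prefixFold_upSweep_succ hf]
      · rw [v₂ q' (by omega), u₁ _ (fun q hq => by rw [pow_succ]; omega), hy q' (by omega), hstep,
          prefixFold_upSweep_succ hf, hx _ (by omega) _ (by rw [pow_succ]; omega)]
        rfl
    obtain ⟨σ', W, D, e, hW, hD, h1, h2, h3⟩ := ih (l + 1) σ₃ (by omega)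
      (by rw [f₃ _ (by decide), f₂ _ (by decide), f₁ _ (by decide), h13])
      (by rw [v₃, pow_succ]; ring)
      (by rw [f₃ _ (by decide), f₂ _ (by decide), f₁ _ (by decide)]; exact hx) hy₃
    · refine ⟨σ', _, _, .loopTrue ?_ (e₁.seq_nil (e₂.seq_nil e₃)) e, ?_, ?_, h1,
        fun b hb hb' => by rw [h2 b hb hb', f₃ b hb, f₂ b hb', f₁ b hb'],
        by rw [h3, g₃, g₂, g₁]⟩
      · have : 2 ^ (l + 1) ≤ 2 ^ h := Nat.pow_le_pow_right (by decide) (by omega)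
        rw [pow_succ] at this
        simp [NumExpr.eval, h14, h13]
        omega
      · have := hop.cost (.get 16 node) (.get 15 leftChild)
        simp only [NumExpr.cost, NumExpr.cost_var, cost_node, cost_leftChild,
          cost_rightChild] at this ⊢
        have h2 := Nat.mul_le_mul_left (2 ^ l) this
        simp only [mul_add, pow_succ] at h2 hW ⊢
        omega
      · have := hop.cost (.get 16 node) (.get 15 leftChild)
        simp only [NumExpr.cost, NumExpr.cost_var, cost_node, cost_leftChild,
          cost_rightChild] at this ⊢
        omega

theorem exec_scan (hop : Computes op f) (hf : ∀ a b c, f (f a b) c = f a (f b c)) (σ : State)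
    (N : ℕ) (hN : σ.num 11 0 = N) :
    ∃ σ' W D, Exec (scan op) σ σ' [] W D ∧ W ≤ 500 * (N + 1) ∧ D ≤ 500 * (Nat.log 2 N + 1) ∧
      (∀ j ≤ N, σ'.num 12 j = prefixFold f (σ.num 10) j) ∧
      (∀ b < 12, σ'.num b = σ.num b) ∧ (∀ b > 16, σ'.num b = σ.num b) ∧ σ'.dst = σ.dst := by
  obtain ⟨σ₁, W₁, h, e₁, v₁, hNh, hh, hW₁, f₁, g₁⟩ := exec_findPow σ N hN
  obtain ⟨σ₂, e₂, v₂, -, f₂, g₂⟩ := exec_scatter σ₁ (.var 11) 15 (.add (.var 13) .pid)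
    (.get 10 .pid) (fun q q' => by simp only [NumExpr.eval, NumExpr.eval_var]; omega)
  simp only [NumExpr.eval, NumExpr.eval_var, f₁ 11 (by decide), hN, v₁, f₁ 10 (by decide)]
    at v₂ e₂
  obtain ⟨σ₃, e₃, v₃, f₃, g₃⟩ := exec_assign σ₂ 14 (.var 13)
  simp only [NumExpr.eval_var, f₂ 13 (by decide), v₁] at v₃
  set x : ℕ → ℕ := fun q => σ₃.num 15 (2 ^ h + q) with hx
  obtain ⟨σ₄, W₄, D₄, e₄, hW₄, hD₄, v₄, u₄, f₄, g₄⟩ := exec_upLoop hop x h h σ₃ le_rfl v₃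
    (fun j hj hj' q hq => by obtain rfl : j = h := le_antisymm hj hj'; simp [upSweep, hx])
  obtain ⟨σ₅, e₅, v₅, -, f₅, g₅⟩ := exec_scatter σ₄ (.const 1) 16 (.add (.const 1) .pid)
    (.const 0) (fun q q' => by simp only [NumExpr.eval]; omega)
  simp only [NumExpr.eval] at v₅ e₅
  obtain ⟨σ₆, W₆, D₆, e₆, hW₆, hD₆, v₆, f₆, g₆⟩ := exec_downLoop hop hf x h h 0 σ₅ (by omega)
    (by rw [f₅ _ (by decide), f₄ _ (by decide) (by decide), f₃ _ (by decide), f₂ _ (by decide),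
      v₁])
    (by rw [f₅ _ (by decide), v₄, pow_zero])
    (by rw [f₅ _ (by decide)]; exact u₄)
    (fun q hq => by
      obtain rfl : q = 0 := by simpa using hq
      simpa [prefixFold] using v₅ 0 (by decide))
  obtain ⟨σ₇, e₇, v₇, f₇, g₇⟩ := exec_fill σ₆ (.add (.var 11) (.const 1)) 12
    (.get 16 (.add (.var 13) .pid))
  have h11 : σ₆.num 11 0 = N := by
    rw [f₆ _ (by decide) (by decide), f₅ _ (by decide), f₄ _ (by decide) (by decide),
      f₃ _ (by decide), f₂ _ (by decide), f₁ _ (by decide), hN]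
  have h13 : σ₆.num 13 0 = 2 ^ h := by
    rw [f₆ _ (by decide) (by decide), f₅ _ (by decide), f₄ _ (by decide) (by decide),
      f₃ _ (by decide), f₂ _ (by decide), v₁]
  simp only [NumExpr.eval, NumExpr.eval_var, h11, h13] at v₇ e₇
  have frame : ∀ b, b < 12 ∨ 16 < b → σ₇.num b = σ.num b := fun b hb => by
    rw [f₇ _ (by omega), f₆ _ (by omega) (by omega), f₅ _ (by omega),
      f₄ _ (by omega) (by omega), f₃ _ (by omega), f₂ _ (by omega), f₁ _ (by omega)]
  have hpow : 2 ^ h ≤ 2 * N + 1 := by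
    rcases hh with rfl | hh
    · simp
    · omega
  have hlog : h ≤ Nat.log 2 N + 1 := by
    rcases hh with rfl | hh
    · omega
    · rcases h with _ | h
      · omega
      · rw [pow_succ] at hh
        have := Nat.le_log_of_pow_le (b := 2) (by decide) (show 2 ^ h ≤ N by omega)
        omega
  have hhpow : h < 2 ^ h := Nat.lt_two_pow_self
  refine ⟨σ₇, _, _, e₁.seq_nil (e₂.seq_nil (e₃.seq_nil (e₄.seq_nil (e₅.seq_nil
    (e₆.seq_nil e₇))))), ?_, ?_, fun j hj => ?_, fun b hb => frame b (.inl hb),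
    fun b hb => frame b (.inr hb), by rw [g₇, g₆, g₅, g₄, g₃, g₂, g₁]⟩
  · simp only [NumExpr.cost, NumExpr.cost_var]
    omega
  · simp only [NumExpr.cost, NumExpr.cost_var]
    omega
  · rw [v₇, if_pos (by omega), v₆ j (by omega)]
    -- Leaves from N on hold arbitrary data, but the prefixes j ≤ N never read them.
    refine prefixFold_congr f fun i hi => ?_
    rw [hx]
    simp only [f₃ 15 (by decide)]
    exact v₂ i (by omega)

end PRAM

namespace PRAM

-- Allotting instances to arcs and discovering vertices

theorem computes_add : Computes .add (· + ·) where
  eval x y σ q := by simp [NumExpr.eval]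
  cost x y := by simp only [NumExpr.cost]; omega

/-- The maximum of two number expressions. -/
def NumExpr.max (x y : NumExpr) : NumExpr := .add x (.sub y x)

theorem computes_max : Computes .max Nat.max where
  eval x y σ q := by
    simp only [NumExpr.max, NumExpr.eval]
    change _ = Max.max (x.eval σ q) (y.eval σ q)
    omega
  cost x y := by simp only [NumExpr.max, NumExpr.cost]; omega

theorem le_prefixFold_max {x : ℕ → ℕ} {i j : ℕ} (h : j < i) : x j ≤ prefixFold Nat.max x i := by
  induction i with
  | zero => omega
  | succ i ih =>
    rcases Nat.lt_succ_iff_lt_or_eq.1 h with h | rfl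
    · exact (ih h).trans (Nat.le_max_left _ _)
    · exact Nat.le_max_right _ _

theorem prefixFold_max_le {x : ℕ → ℕ} {i b : ℕ} (h : ∀ j < i, x j ≤ b) :
    prefixFold Nat.max x i ≤ b := by
  induction i with
  | zero => exact Nat.zero_le _
  | succ i ih => exact Nat.max_le.2 ⟨ih fun j hj => h j (by omega), h i (by omega)⟩

theorem prefixFold_add_eq_sum (x : ℕ → ℕ) (i : ℕ) :
    prefixFold (· + ·) x i = ∑ j ∈ Finset.range i, x j := by
  induction i with
  | zero => rfl
  | succ i ih => rw [prefixFold, Finset.sum_range_succ, ih]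

theorem monotone_prefixFold_add (x : ℕ → ℕ) : Monotone (prefixFold (· + ·) x) :=
  monotone_nat_of_le_succ fun _ => Nat.le_add_right _ _

theorem exists_le_lt_of_lt {O : ℕ → ℕ} {K y : ℕ} (h0 : O 0 = 0) (h : y < O K) :
    ∃ e < K, O e ≤ y ∧ y < O (e + 1) := by
  induction K with
  | zero => omega
  | succ K ih =>
    rcases lt_or_ge y (O K) with hy | hy
    · obtain ⟨e, he, h1⟩ := ih hy
      exact ⟨e, by omega, h1⟩
    · exact ⟨K, by omega, hy, h⟩

/-- The candidate (array `4`) of an instance. -/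
def cand : NumExpr := .get 4 .pid

theorem eval_cand (σ : State) (q : ℕ) : cand.eval σ q = σ.num 4 q := by simp [cand, NumExpr.eval]

theorem cost_cand : cand.cost = 2 := by simp [cand, NumExpr.cost]

/-- Offsets of the arcs that leave the marked (array `5`) candidates: array `17`, total scalar
`9`. -/
def offsets : Program :=
  .seq (fill (.var 3) 10 (.const 0))
    (.seq (fillIf (.var 3) (.get 5 .pid) 10 (.sub (.get 1 (.add cand (.const 1))) (.get 1 cand)))
      (.seq (assign 11 (.var 3))
        (.seq (scan .add)
          (.seq (fill (.add (.var 3) (.const 1)) 17 (.get 12 .pid))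
            (assign 9 (.get 12 (.var 3)))))))

/-- The number of arcs allotted to the candidate `e`. -/
def State.width (σ : State) (e : ℕ) : ℕ :=
  if σ.num 5 e ≠ 0 then σ.num 1 (σ.num 4 e + 1) - σ.num 1 (σ.num 4 e) else 0

theorem exec_offsets (σ : State) (K : ℕ) (hK : σ.num 3 0 = K) :
    ∃ σ' W D, Exec offsets σ σ' [] W D ∧ W ≤ 600 * (K + 1) ∧ D ≤ 600 * (Nat.log 2 K + 1) ∧
      (∀ j ≤ K, σ'.num 17 j = prefixFold (· + ·) σ.width j) ∧
      σ'.num 9 0 = prefixFold (· + ·) σ.width K ∧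
      (∀ b < 9, σ'.num b = σ.num b) ∧ σ'.dst = σ.dst := by
  obtain ⟨σ₁, e₁, v₁, f₁, g₁⟩ := exec_fill σ (.var 3) 10 (.const 0)
  simp only [NumExpr.eval, NumExpr.eval_var, hK] at v₁ e₁
  obtain ⟨σ₂, e₂, v₂, f₂, g₂⟩ := exec_fillIf σ₁ (.var 3) (.get 5 .pid) 10
    (.sub (.get 1 (.add cand (.const 1))) (.get 1 cand))
  simp only [NumExpr.eval, NumExpr.eval_var, eval_cand, f₁ 3 (by decide), f₁ 5 (by decide),
    f₁ 1 (by decide), f₁ 4 (by decide), hK, v₁] at v₂ e₂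
  obtain ⟨σ₃, e₃, v₃, f₃, g₃⟩ := exec_assign σ₂ 11 (.var 3)
  simp only [NumExpr.eval_var, f₁ 3 (by decide), f₂ 3 (by decide), hK] at v₃
  obtain ⟨σ₄, W₄, D₄, e₄, hW₄, hD₄, v₄, f₄, f₄', g₄⟩ :=
    exec_scan computes_add Nat.add_assoc σ₃ K v₃
  obtain ⟨σ₅, e₅, v₅, f₅, g₅⟩ := exec_fill σ₄ (.add (.var 3) (.const 1)) 17 (.get 12 .pid)
  simp only [NumExpr.eval, NumExpr.eval_var, f₄ 3 (by decide), f₃ 3 (by decide),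
    f₂ 3 (by decide), f₁ 3 (by decide), hK] at v₅ e₅
  obtain ⟨σ₆, e₆, v₆, f₆, g₆⟩ := exec_assign σ₅ 9 (.get 12 (.var 3))
  simp only [NumExpr.eval, NumExpr.eval_var, f₅ 12 (by decide), f₅ 3 (by decide),
    f₄ 3 (by decide), f₃ 3 (by decide), f₂ 3 (by decide), f₁ 3 (by decide), hK] at v₆
  have key : ∀ j ≤ K, σ₄.num 12 j = prefixFold (· + ·) σ.width j := fun j hj => by
    rw [v₄ j hj]
    refine prefixFold_congr _ fun i hi => ?_
    have hi' : i < K := by omega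
    rw [f₃ 10 (by decide), v₂]
    simp [hi', State.width]
  refine ⟨σ₆, _, _, e₁.seq_nil (e₂.seq_nil (e₃.seq_nil (e₄.seq_nil (e₅.seq_nil e₆)))), ?_, ?_,
    fun j hj => ?_, ?_, fun b hb => ?_, by rw [g₆, g₅, g₄, g₃, g₂, g₁]⟩
  · simp only [NumExpr.cost, NumExpr.cost_var, cost_cand]
    omega
  · simp only [NumExpr.cost, NumExpr.cost_var, cost_cand]
    omega
  · rw [f₆ 17 (by decide), v₅, if_pos (by omega), key j hj]
  · rw [v₆, key K le_rfl]
  · rw [f₆ _ (by omega), f₅ _ (by omega), f₄ _ (by omega), f₃ _ (by omega), f₂ _ (by omega),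
      f₁ _ (by omega)]

/-- The owners of the arcs: array `12`, shifted by one. -/
def owners : Program :=
  .seq (fill (.var 9) 10 (.const 0))
    (.seq (.setNum (.var 3) (.lt (.get 17 .pid) (.get 17 (.add .pid (.const 1)))) 10
        (.get 17 .pid) .pid)
      (.seq (assign 11 (.var 9)) (scan .max)))

/-- Each candidate with arcs writes its index at the start of its range. Starts increase with the
index, so the maximum over the cells up to y is the owner of y; the scan is exclusive, hence y + 1.
A candidate without arcs must stay silent, since it could share its cell with the next range and win
it. -/
theorem exec_owners (σ : State) (K M : ℕ) (O : ℕ → ℕ) (hK : σ.num 3 0 = K) (hM : σ.num 9 0 = M)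
    (hO : ∀ j ≤ K, σ.num 17 j = O j) (hmono : Monotone O) :
    ∃ σ' W D, Exec owners σ σ' [] W D ∧ W ≤ 600 * (K + M + 1) ∧ D ≤ 600 * (Nat.log 2 M + 1) ∧
      (∀ y < M, ∀ e < K, O e ≤ y → y < O (e + 1) → σ'.num 12 (y + 1) = e) ∧
      (∀ b < 10, σ'.num b = σ.num b) ∧ σ'.num 17 = σ.num 17 ∧ σ'.dst = σ.dst := by
  obtain ⟨σ₁, e₁, v₁, f₁, g₁⟩ := exec_fill σ (.var 9) 10 (.const 0)
  simp only [NumExpr.eval, NumExpr.eval_var, hM] at v₁ e₁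
  obtain ⟨σ₂, e₂, v₂, f₂, g₂⟩ := exec_setNum σ₁ (.var 3)
    (.lt (.get 17 .pid) (.get 17 (.add .pid (.const 1)))) 10 (.get 17 .pid) .pid
  simp only [NumExpr.eval, NumExpr.eval_var, f₁ 3 (by decide), f₁ 17 (by decide), hK] at v₂ e₂
  obtain ⟨σ₃, e₃, v₃, f₃, g₃⟩ := exec_assign σ₂ 11 (.var 9)
  simp only [NumExpr.eval_var, f₁ 9 (by decide), f₂ 9 (by decide), hM] at v₃
  obtain ⟨σ₄, W₄, D₄, e₄, hW₄, hD₄, v₄, f₄, f₄', g₄⟩ :=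
    exec_scan computes_max Nat.max_assoc σ₃ M v₃
  refine ⟨σ₄, _, _, e₁.seq_nil (e₂.seq_nil (e₃.seq_nil e₄)), ?_, ?_, ?_, fun b hb => ?_, ?_,
    by rw [g₄, g₃, g₂, g₁]⟩
  · simp only [NumExpr.cost, NumExpr.cost_var]
    omega
  · simp only [NumExpr.cost, NumExpr.cost_var]
    omega
  · intro y hy e he h1 h2
    have hinj : ∀ e < K, ∀ e' < K, O e < O (e + 1) → O e' < O (e' + 1) → O e' = O e → e' = e := by
      intro e _ e' _ h h' heq
      rcases lt_trichotomy e e' with hlt | hlt | hlt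
      · have := hmono (Nat.succ_le_of_lt hlt)
        simp only [Nat.succ_eq_add_one] at this
        omega
      · exact hlt.symm
      · have := hmono (Nat.succ_le_of_lt hlt)
        simp only [Nat.succ_eq_add_one] at this
        omega
    have hstart : ∀ e < K, O e < O (e + 1) → σ₂.num 10 (O e) = e := by
      intro e he h
      rw [v₂]
      refine priorityWrite_of_forall_eq (q := e) (x := fun q => q) he ?_ (hO e he.le) ?_
      · simp [hO e he.le, hO (e + 1) he, h]
      · intro e' he' h' h''
        have h0 : O e' < O (e' + 1) := by
          by_contra h0
          simp [hO e' he'.le, hO (e' + 1) he', h0] at h'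
        rw [hO e' he'.le] at h''
        exact hinj e he e' he' h h0 h''
    have hrest : ∀ z < M, (∀ e < K, O e < O (e + 1) → O e ≠ z) → σ₂.num 10 z = 0 := by
      intro z hz h
      rw [v₂, priorityWrite_of_forall_ne, v₁, if_pos hz]
      intro e' he' h' h''
      have h0 : O e' < O (e' + 1) := by
        by_contra h0
        simp [hO e' he'.le, hO (e' + 1) he', h0] at h'
      rw [hO e' he'.le] at h''
      exact h e' he' h0 h''
    rw [v₄ _ hy]
    apply le_antisymm
    · refine prefixFold_max_le fun z hz => ?_
      rw [f₃ 10 (by decide)]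
      by_cases hz' : ∃ e < K, O e < O (e + 1) ∧ O e = z
      · obtain ⟨e', he', h3, rfl⟩ := hz'
        rw [hstart e' he' h3]
        by_contra! hlt
        have := hmono (Nat.succ_le_of_lt hlt)
        simp only [Nat.succ_eq_add_one] at this
        omega
      · push Not at hz'
        rw [hrest z (by omega) hz']
        exact Nat.zero_le _
    · refine le_trans ?_ (le_prefixFold_max (j := O e) (by omega))
      rw [f₃ 10 (by decide), hstart e he (by omega)]
  · rw [f₄ _ (by omega), f₃ _ (by omega), f₂ _ (by omega), f₁ _ (by omega)]
  · rw [f₄' _ (by omega), f₃ _ (by omega), f₂ _ (by omega), f₁ _ (by omega)]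

/-- Replaces the candidates by the heads of the arcs. -/
def gather : Program :=
  fill (.var 9) 4 (.get 2 (.add (.get 1 (.get 4 (.get 12 (.add .pid (.const 1)))))
    (.sub .pid (.get 17 (.get 12 (.add .pid (.const 1)))))))

/-- Marks, for every undiscovered candidate, its first occurrence, and discovers it. -/
def discover : Program :=
  .seq (.setNum (.var 9) (.dstLt (.ofNum (.var 7)) (.get 1 cand)) 6 cand .pid)
    (.seq (fill (.var 9) 5 (.const 0))
      (.seq (fillIf (.var 9) (.dstLt (.ofNum (.var 7)) (.get 1 cand)) 5
          (.lt .pid (.add (.get 6 cand) (.const 1))))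
        (.seq (assign 7 (.add (.var 7) (.const 1)))
          (.seq (.setDst (.var 9) (.get 5 .pid) 1 cand (.ofNum (.var 7)))
            (.seq (assign 8 (.const 0))
              (.seq (.setNum (.var 9) (.get 5 .pid) 8 (.const 0) (.const 1))
                (assign 3 (.var 9))))))))

/-- All instances holding the same undiscovered vertex write their index into its cell of array 6,
where the least survives; an instance is marked when its index does not exceed that value. Array 6
is never cleared, because only cells just written are read. -/
theorem exec_discover (σ : State) (M t : ℕ) (hM : σ.num 9 0 = M) (ht : σ.num 7 0 = t) :
    ∃ σ' W D, Exec discover σ σ' [] W D ∧ W ≤ 300 * (M + 1) ∧ D ≤ 300 ∧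
      (∀ j < M, σ'.num 5 j ≠ 0 ↔ (t : ℝ≥0∞) < σ.dst 1 (σ.num 4 j) ∧
        ∀ i < M, σ.num 4 i = σ.num 4 j → j ≤ i) ∧
      (∀ v, (∃ j < M, σ.num 4 j = v ∧ (t : ℝ≥0∞) < σ.dst 1 v) → σ'.dst 1 v = (t + 1 : ℕ)) ∧
      (∀ v, (¬ ∃ j < M, σ.num 4 j = v ∧ (t : ℝ≥0∞) < σ.dst 1 v) → σ'.dst 1 v = σ.dst 1 v) ∧
      (σ'.num 8 0 ≠ 0 ↔ ∃ j < M, (t : ℝ≥0∞) < σ.dst 1 (σ.num 4 j)) ∧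
      σ'.num 7 0 = t + 1 ∧ σ'.num 3 0 = M ∧ σ'.num 4 = σ.num 4 ∧
      (∀ b < 3, σ'.num b = σ.num b) ∧ (∀ b ≠ 1, σ'.dst b = σ.dst b) := by
  obtain ⟨σ₁, e₁, v₁, f₁, g₁⟩ := exec_setNum σ (.var 9)
    (.dstLt (.ofNum (.var 7)) (.get 1 cand)) 6 cand .pid
  simp only [NumExpr.eval, DstExpr.eval, NumExpr.eval_var, eval_cand, hM, ht] at v₁ e₁
  obtain ⟨σ₂, e₂, v₂, f₂, g₂⟩ := exec_fill σ₁ (.var 9) 5 (.const 0)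
  simp only [NumExpr.eval, NumExpr.eval_var, f₁ 9 (by decide), hM] at v₂ e₂
  obtain ⟨σ₃, e₃, v₃, f₃, g₃⟩ := exec_fillIf σ₂ (.var 9)
    (.dstLt (.ofNum (.var 7)) (.get 1 cand)) 5 (.lt .pid (.add (.get 6 cand) (.const 1)))
  simp only [NumExpr.eval, DstExpr.eval, NumExpr.eval_var, eval_cand, f₁ 9 (by decide),
    f₂ 9 (by decide), f₁ 7 (by decide), f₂ 7 (by decide), f₂ 4 (by decide), f₁ 4 (by decide),
    f₂ 6 (by decide), g₂, g₁, hM, ht, v₂] at v₃ e₃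
  obtain ⟨σ₄, e₄, v₄, f₄, g₄⟩ := exec_assign σ₃ 7 (.add (.var 7) (.const 1))
  simp only [NumExpr.eval, NumExpr.eval_var, f₁ 7 (by decide), f₂ 7 (by decide),
    f₃ 7 (by decide), ht] at v₄
  obtain ⟨σ₅, e₅, v₅, f₅, g₅⟩ := exec_setDst σ₄ (.var 9) (.get 5 .pid) 1 cand (.ofNum (.var 7))
  simp only [NumExpr.eval, DstExpr.eval, NumExpr.eval_var, eval_cand, f₁ 9 (by decide),
    f₂ 9 (by decide), f₃ 9 (by decide), f₄ 9 (by decide), f₄ 5 (by decide), f₄ 4 (by decide),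
    f₃ 4 (by decide), f₂ 4 (by decide), f₁ 4 (by decide), v₄, hM, g₄, g₃, g₂, g₁] at v₅ e₅
  obtain ⟨σ₆, e₆, v₆, f₆, g₆⟩ := exec_assign σ₅ 8 (.const 0)
  simp only [NumExpr.eval] at v₆
  obtain ⟨σ₇, e₇, v₇, f₇, g₇⟩ := exec_setNum σ₆ (.var 9) (.get 5 .pid) 8 (.const 0) (.const 1)
  have h9 : σ₆.num 9 0 = M := by
    rw [f₆ _ (by decide), g₅, f₄ _ (by decide), f₃ _ (by decide), f₂ _ (by decide),
      f₁ _ (by decide), hM]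
  have h5 : σ₆.num 5 = σ₃.num 5 := by
    rw [f₆ _ (by decide), g₅, f₄ _ (by decide)]
  simp only [NumExpr.eval, NumExpr.eval_var, h9, h5] at v₇ e₇
  obtain ⟨σ₈, e₈, v₈, f₈, g₈⟩ := exec_assign σ₇ 3 (.var 9)
  simp only [NumExpr.eval_var, f₇ 9 (by decide), h9] at v₈
  -- the marks are the first occurrences of undiscovered candidates
  have hwin : ∀ j < M, σ₃.num 5 j ≠ 0 ↔ (t : ℝ≥0∞) < σ.dst 1 (σ.num 4 j) ∧
      ∀ i < M, σ.num 4 i = σ.num 4 j → j ≤ i := by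
    intro j hj
    rw [v₃]
    by_cases hlt : (t : ℝ≥0∞) < σ.dst 1 (σ.num 4 j)
    · have hact : ∀ i, σ.num 4 i = σ.num 4 j →
          (if (t : ℝ≥0∞) < σ.dst 1 (σ.num 4 i) then 1 else 0) ≠ 0 := by
        intro i hi
        rw [hi, if_pos hlt]
        decide
      obtain ⟨i, hi, -, hij, hval⟩ := exists_priorityWrite_eq (x := fun q => q)
        (act := fun q => (if (t : ℝ≥0∞) < σ.dst 1 (σ.num 4 q) then 1 else 0) ≠ 0)
        (i := fun q => σ.num 4 q) (old := σ.num 6) hj (hact j rfl) rfl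
      have hle : ∀ i < M, σ.num 4 i = σ.num 4 j → σ₁.num 6 (σ.num 4 j) ≤ i := by
        intro i' hi' hij'
        rw [v₁]
        exact priorityWrite_le (x := fun q => q) (i := fun q => σ.num 4 q)
          (act := fun q => (if (t : ℝ≥0∞) < σ.dst 1 (σ.num 4 q) then 1 else 0) ≠ 0)
          hi' (hact i' hij') hij'
      simp only [hj, hlt, if_true, true_and, ne_eq, one_ne_zero, not_false_eq_true, and_self]
      have hval' : σ₁.num 6 (σ.num 4 j) = i := by rw [v₁]; exact hval
      rw [hval'] at hle ⊢
      constructor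
      · intro h i' hi' hij'
        have := hle i' hi' hij'
        by_contra hcon
        rw [if_neg (by omega)] at h
        exact h rfl
      · intro h
        have := h i hi hij
        rw [if_pos (by omega)]
        decide
    · simp [hj, hlt]
  have hfirst : ∀ v, (∃ j < M, σ.num 4 j = v ∧ (t : ℝ≥0∞) < σ.dst 1 v) →
      ∃ j < M, σ₃.num 5 j ≠ 0 ∧ σ.num 4 j = v := by
    intro v h
    classical
    have hs := Nat.find_spec h
    have hmin := fun m => Nat.find_min' h (m := m)
    refine ⟨Nat.find h, hs.1, ?_, hs.2.1⟩
    rw [hwin _ hs.1, hs.2.1]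
    exact ⟨hs.2.2, fun i hi hiv => hmin i ⟨hi, hiv, hs.2.2⟩⟩
  have hdst : σ₈.dst = σ₅.dst := by rw [g₈, g₇, g₆]
  refine ⟨σ₈, _, _, e₁.seq_nil (e₂.seq_nil (e₃.seq_nil (e₄.seq_nil (e₅.seq_nil
    (e₆.seq_nil (e₇.seq_nil e₈)))))), ?_, ?_, fun j hj => ?_, fun v hv => ?_, fun v hv => ?_, ?_,
    ?_, v₈, ?_, fun b hb => ?_, fun b hb => ?_⟩
  · simp only [NumExpr.cost, DstExpr.cost, NumExpr.cost_var, cost_cand]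
    omega
  · simp only [NumExpr.cost, DstExpr.cost, NumExpr.cost_var, cost_cand]
    omega
  · rw [f₈ _ (by decide), f₇ _ (by decide), h5, hwin j hj]
  · obtain ⟨j, hj, hwj, hjv⟩ := hfirst v hv
    rw [hdst, v₅]
    exact priorityWrite_of_forall_eq (x := fun _ => ((t + 1 : ℕ) : ℝ≥0∞))
      (i := fun q => σ.num 4 q) hj hwj hjv fun _ _ _ _ => rfl
  · rw [hdst, v₅]
    refine priorityWrite_of_forall_ne fun q hq hw hqv => hv ⟨q, hq, hqv, ?_⟩
    rw [← hqv]
    exact ((hwin q hq).1 hw).1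
  · rw [f₈ _ (by decide), v₇]
    constructor
    · intro h
      by_contra! hcon
      refine h ?_
      rw [priorityWrite_of_forall_ne, v₆]
      intro q hq hw
      exact absurd ((hwin q hq).1 hw).1 (not_lt.2 (hcon q hq))
    · rintro ⟨j, hj, hlt⟩
      obtain ⟨j', hj', hw, -⟩ := hfirst _ ⟨j, hj, rfl, hlt⟩
      rw [priorityWrite_of_forall_eq (x := fun _ => 1) (i := fun _ => 0) hj' hw rfl
        fun _ _ _ _ => rfl]
      decide
  · rw [f₈ _ (by decide), f₇ _ (by decide), f₆ _ (by decide), g₅, v₄]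
  · rw [f₈ _ (by decide), f₇ _ (by decide), f₆ _ (by decide), g₅, f₄ _ (by decide),
      f₃ _ (by decide), f₂ _ (by decide), f₁ _ (by decide)]
  · rw [f₈ _ (by omega), f₇ _ (by omega), f₆ _ (by omega), g₅, f₄ _ (by omega),
      f₃ _ (by omega), f₂ _ (by omega), f₁ _ (by omega)]
  · rw [hdst, f₅ b hb, g₄, g₃, g₂, g₁]

end PRAM

namespace RadiusStepping

-- When a substep is the last one of its step

variable {V : Type*} [Fintype V] {G : SimpleGraph V} {w : Sym2 V → ℝ≥0}

/-- Either d < t + 1 excludes level t + 1, or there is no such level; the second case also covers d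
= ∞. -/
theorem setOf_levelDelta_succ_le (s : V) {t : ℕ} {d : ℝ≥0∞} (hd : (t : ℝ≥0∞) ≤ d)
    (h : d < (t + 1 : ℕ) ∨ levelCount G s ≤ t + 1) :
    {v | levelDelta G s (t + 1) v ≤ d} = {v | G.dist s v < t + 1} := by
  ext v
  change levelDelta G s (t + 1) v ≤ d ↔ G.dist s v < t + 1
  constructor
  · intro hv
    rcases h with h | h
    · have : (G.dist s v : ℝ≥0∞) < (t + 1 : ℕ) := ((dist_le_levelDelta s v _).trans hv).trans_lt h
      exact_mod_cast this
    · exact (dist_lt_levelCount s v).trans_le h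
  · intro hv
    rw [levelDelta_of_le hv.le]
    refine le_trans ?_ hd
    exact_mod_cast Nat.le_of_lt_succ hv

theorem substeps_last (hG : G.Connected) (hw : ∀ e ∈ G.edgeSet, w e = 1) (s : V) {t₀ t : ℕ}
    {d : ℝ≥0∞} (h₀ : t₀ ≤ t) (hd : (t : ℝ≥0∞) ≤ d)
    (h : d < (t + 1 : ℕ) ∨ levelCount G s ≤ t + 1) :
    Substeps G w {v | G.dist s v < t₀} d (levelDelta G s t) (levelDelta G s (t + 1)) := by
  have h1 := substep_levelDelta hG hw s h₀ hd
  have h2 := Substeps.last (G := G) (w := w) (S := {v | G.dist s v < t₀}) (d := d)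
    (levelDelta G s t)
  rw [h1] at h2
  refine h2 fun v hv => ?_
  have hv' : v ∈ {v | levelDelta G s (t + 1) v ≤ d} := hv
  rw [setOf_levelDelta_succ_le s hd h] at hv'
  have hv'' : G.dist s v < t + 1 := hv'
  rw [levelDelta_of_le hv''.le, levelDelta_of_le (by omega)]

/-- A vertex of level t + 1 drops from ∞ to t + 1 ≤ d, which forces another substep. -/
theorem substeps_again (hG : G.Connected) (hw : ∀ e ∈ G.edgeSet, w e = 1) (s : V) {t₀ t : ℕ}
    {d : ℝ≥0∞} {δ' : V → ℝ≥0∞} (h₀ : t₀ ≤ t) (hd : ((t + 1 : ℕ) : ℝ≥0∞) ≤ d)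
    (h : t + 1 < levelCount G s)
    (hs : Substeps G w {v | G.dist s v < t₀} d (levelDelta G s (t + 1)) δ') :
    Substeps G w {v | G.dist s v < t₀} d (levelDelta G s t) δ' := by
  have h1 := substep_levelDelta hG hw s h₀
    (le_trans (by exact_mod_cast Nat.le_succ t) hd : (t : ℝ≥0∞) ≤ d)
  obtain ⟨v, hv⟩ := (lt_levelCount_iff hG s _).1 h
  refine .again _ _ ⟨v, ?_, ?_⟩ (by rwa [h1])
  · rwa [h1, levelDelta_of_le hv.le, hv]
  · rw [h1, levelDelta_of_le hv.le, levelDelta_of_lt (by omega)]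
    exact ENNReal.natCast_ne_top _

end RadiusStepping

namespace PRAM

-- The level invariant and the loop over the levels

open RadiusStepping

variable {n : ℕ} {G : SimpleGraph (Fin n)} {s : Fin n} {r : Fin n → ℝ≥0∞} {σ₀ : State}

/-- The memory `σ` describes the distance level `t`: the marked ones among the `K` candidates are
its vertices, and the tentative distances are known up to this level. -/
structure Level (G : SimpleGraph (Fin n)) (s : Fin n) (σ₀ : State) (t K : ℕ) (σ : State) :
    Prop where
  offset : σ.num 1 = σ₀.num 1
  neighbor : σ.num 2 = σ₀.num 2
  radius : σ.dst 0 = σ₀.dst 0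
  size : σ.num 3 0 = K
  level : σ.num 7 0 = t
  inj : ∀ i < K, ∀ j < K, σ.num 5 i ≠ 0 → σ.num 5 j ≠ 0 → σ.num 4 i = σ.num 4 j → i = j
  mem : ∀ j < K, σ.num 5 j ≠ 0 → ∃ v : Fin n, G.dist s v = t ∧ σ.num 4 j = v
  cover : ∀ v : Fin n, G.dist s v = t → ∃ j < K, σ.num 5 j ≠ 0 ∧ σ.num 4 j = v
  delta : ∀ v : Fin n, σ.dst 1 v = levelDelta G s t v

theorem Level.congr {t K : ℕ} {σ σ' : State} (h : Level G s σ₀ t K σ) (hnum : σ'.num = σ.num)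
    (h0 : σ'.dst 0 = σ.dst 0) (h1 : σ'.dst 1 = σ.dst 1) : Level G s σ₀ t K σ' where
  offset := by rw [hnum, h.offset]
  neighbor := by rw [hnum, h.neighbor]
  radius := by rw [h0, h.radius]
  size := by rw [hnum, h.size]
  level := by rw [hnum, h.level]
  inj := by rw [hnum]; exact h.inj
  mem := by rw [hnum]; exact h.mem
  cover := by rw [hnum]; exact h.cover
  delta := by rw [h1]; exact h.delta

theorem Level.width_eq (hin : IsInput G s r σ₀) {t K : ℕ} {σ : State} (h : Level G s σ₀ t K σ)
    {j : ℕ} {v : Fin n} (hw : σ.num 5 j ≠ 0) (hv : σ.num 4 j = v) :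
    σ.width j = (G.neighborSet v).ncard := by
  rw [State.width, if_pos hw, hv, h.offset, hin.offset_succ v]
  omega

open Classical in
-- Marked candidates correspond bijectively to the vertices of the level, and unmarked ones have
-- width 0.
theorem Level.prefixFold_width (hin : IsInput G s r σ₀) {t K : ℕ} {σ : State}
    (h : Level G s σ₀ t K σ) : prefixFold (· + ·) σ.width K = arcCount G s t := by
  rw [prefixFold_add_eq_sum, arcCount,
    ← Finset.sum_filter_of_ne (p := fun j => σ.num 5 j ≠ 0) (fun j _ hj hw => by
      simp [State.width, hw] at hj)]
  symm
  choose! c hc using h.cover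
  refine Finset.sum_bij (fun v _ => c v) ?_ ?_ ?_ ?_
  · intro v hv
    obtain ⟨h1, h2, -⟩ := hc v (by simpa using hv)
    simp [h1, h2]
  · intro v hv v' hv' heq
    obtain ⟨-, -, h1⟩ := hc v (by simpa using hv)
    obtain ⟨-, -, h2⟩ := hc v' (by simpa using hv')
    rw [heq, h2] at h1
    exact Fin.ext h1.symm
  · intro j hj
    rw [Finset.mem_filter, Finset.mem_range] at hj
    obtain ⟨v, hv, hjv⟩ := h.mem j hj.1 hj.2
    obtain ⟨h1, h2, h3⟩ := hc v hv
    exact ⟨v, by simpa using hv, h.inj _ h1 _ hj.1 h2 hj.2 (h3.trans hjv.symm)⟩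
  · intro v hv
    obtain ⟨h1, h2, h3⟩ := hc v (by simpa using hv)
    exact (h.width_eq hin h2 h3).symm

/-- Replaces the description of a level by that of the next one. -/
def expand : Program := .seq offsets (.seq owners (.seq gather discover))

/-- Instance y with owner e fetches arc number y - O e of that candidate. A head is at most one
level further than its tail, so the undiscovered heads are exactly level t + 1. Since the list keeps
all heads, its new length is the arc count. -/
theorem exec_expand (hG : G.Connected) (hin : IsInput G s r σ₀) {t K : ℕ} {σ : State}
    (h : Level G s σ₀ t K σ) :
    ∃ σ' W D, Exec expand σ σ' [] W D ∧ W ≤ 2000 * (K + arcCount G s t + 1) ∧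
      D ≤ 2000 * (Nat.log 2 K + Nat.log 2 (arcCount G s t) + 1) ∧
      Level G s σ₀ (t + 1) (arcCount G s t) σ' ∧
      (σ'.num 8 0 ≠ 0 ↔ t + 1 < levelCount G s) ∧ σ'.dst 2 = σ.dst 2 := by
  obtain ⟨σ₁, W₁, D₁, e₁, hW₁, hD₁, hO, hM, f₁, g₁⟩ := exec_offsets σ K h.size
  have hOK := h.prefixFold_width hin
  rw [hOK] at hM
  set M := arcCount G s t with hMdef
  set O := prefixFold (· + ·) σ.width with hOdef
  have hmono : Monotone O := monotone_prefixFold_add _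
  have hOsucc : ∀ e, O (e + 1) = O e + σ.width e := fun _ => rfl
  obtain ⟨σ₂, W₂, D₂, e₂, hW₂, hD₂, hown, f₂, f₂', g₂⟩ := exec_owners σ₁ K M O
    (by rw [f₁ _ (by decide), h.size]) hM hO hmono
  obtain ⟨σ₃, e₃, v₃, f₃, g₃⟩ := exec_fill σ₂ (.var 9) 4
    (.get 2 (.add (.get 1 (.get 4 (.get 12 (.add .pid (.const 1)))))
      (.sub .pid (.get 17 (.get 12 (.add .pid (.const 1)))))))
  simp only [NumExpr.eval, NumExpr.eval_var, f₂ 9 (by decide), hM, f₂ 1 (by decide),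
    f₁ 1 (by decide), f₂ 2 (by decide), f₁ 2 (by decide), f₂ 4 (by decide), f₁ 4 (by decide),
    h.offset, h.neighbor, f₂'] at v₃ e₃
  obtain ⟨σ₄, W₄, D₄, e₄, hW₄, hD₄, hwin, hnew, hold, hne, hlev, hsize, hcand, f₄, g₄⟩ :=
    exec_discover σ₃ M t (by rw [f₃ _ (by decide), f₂ _ (by decide), hM])
      (by rw [f₃ _ (by decide), f₂ _ (by decide), f₁ _ (by decide), h.level])
  have hdst : σ₃.dst = σ.dst := by rw [g₃, g₂, g₁]
  rw [hdst] at hwin hnew hold hne g₄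
  -- the new candidates are the neighbours of the level
  have hc₁ : ∀ y < M, ∃ v u : Fin n, G.dist s v = t ∧ G.Adj v u ∧ σ₃.num 4 y = u := by
    intro y hy
    obtain ⟨e, he, hy1, hy2⟩ := exists_le_lt_of_lt (O := O) (K := K) rfl (by rw [hOK]; exact hy)
    have hwe : σ.num 5 e ≠ 0 := by
      intro hcon
      rw [hOsucc, State.width, if_neg (by simpa using hcon)] at hy2
      omega
    obtain ⟨v, hv, hev⟩ := h.mem e he hwe
    rw [hOsucc, h.width_eq hin hwe hev] at hy2
    have harc : σ₀.num 1 v + (y - O e) ∈ Set.Ico (σ₀.num 1 v) (σ₀.num 1 ((v : ℕ) + 1)) := by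
      rw [hin.offset_succ v, Set.mem_Ico]
      omega
    obtain ⟨u, hu, huv⟩ := (hin.neighbors v).mapsTo harc
    refine ⟨v, u, hv, hu, ?_⟩
    rw [v₃, if_pos hy, hown y hy e he hy1 (by rw [hOsucc, h.width_eq hin hwe hev]; omega), hev,
      hO e he.le]
    exact huv.symm
  have hc₂ : ∀ v u : Fin n, G.dist s v = t → G.Adj v u → ∃ y < M, σ₃.num 4 y = u := by
    intro v u hv hu
    obtain ⟨e, he, hwe, hev⟩ := h.cover v hv
    obtain ⟨a, ha, hau⟩ := (hin.neighbors v).surjOn ⟨u, hu, rfl⟩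
    rw [Set.mem_Ico, hin.offset_succ v] at ha
    have hlt : O e + (a - σ₀.num 1 v) < O (e + 1) := by
      rw [hOsucc, h.width_eq hin hwe hev]
      omega
    have hy : O e + (a - σ₀.num 1 v) < M := by
      rw [← hOK]
      exact hlt.trans_le (hmono he)
    refine ⟨O e + (a - σ₀.num 1 v), hy, ?_⟩
    rw [v₃, if_pos hy, hown _ hy e he (by omega) hlt, hev, hO e he.le]
    rw [show σ₀.num 1 v + (O e + (a - σ₀.num 1 v) - O e) = a by omega]
    exact hau
  have hdelta : ∀ v : Fin n, (t : ℝ≥0∞) < σ.dst 1 v ↔ t < G.dist s v := fun v => by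
    rw [h.delta, lt_levelDelta_iff]
  have hnext : ∀ v : Fin n, (∃ j < M, σ₃.num 4 j = v ∧ (t : ℝ≥0∞) < σ.dst 1 v) ↔
      G.dist s v = t + 1 := by
    intro v
    constructor
    · rintro ⟨j, hj, hjv, hlt⟩
      rw [hdelta] at hlt
      obtain ⟨x, u, hx, hadj, hju⟩ := hc₁ j hj
      obtain rfl : u = v := Fin.ext (hju.symm.trans hjv)
      have := dist_le_succ_of_adj hG (s := s) hadj
      omega
    · intro hv
      obtain ⟨x, hadj, hx⟩ := exists_adj_dist_eq hG hv
      obtain ⟨j, hj, hjv⟩ := hc₂ x v hx hadj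
      exact ⟨j, hj, hjv, by rw [hdelta]; omega⟩
  refine ⟨σ₄, _, _, e₁.seq_nil (e₂.seq_nil (e₃.seq_nil e₄)), ?_, ?_, ?_, ?_, ?_⟩
  · simp only [NumExpr.cost, NumExpr.cost_var]
    omega
  · simp only [NumExpr.cost, NumExpr.cost_var]
    omega
  · refine ⟨?_, ?_, ?_, hsize, hlev, ?_, ?_, ?_, ?_⟩
    · rw [f₄ _ (by decide), f₃ _ (by decide), f₂ _ (by decide), f₁ _ (by decide), h.offset]
    · rw [f₄ _ (by decide), f₃ _ (by decide), f₂ _ (by decide), f₁ _ (by decide), h.neighbor]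
    · rw [g₄ _ (by decide), h.radius]
    · rw [hcand]
      intro i hi j hj hwi hwj hij
      exact le_antisymm (((hwin i hi).1 hwi).2 j hj hij.symm) (((hwin j hj).1 hwj).2 i hi hij)
    · rw [hcand]
      intro j hj hwj
      obtain ⟨x, u, -, -, hju⟩ := hc₁ j hj
      have hlt := ((hwin j hj).1 hwj).1
      rw [hju] at hlt
      exact ⟨u, (hnext u).1 ⟨j, hj, hju, hlt⟩, hju⟩
    · rw [hcand]
      intro v hv
      have hex := (hnext v).2 hv
      classical
      have hs := Nat.find_spec hex
      have hmin := fun m => Nat.find_min' hex (m := m)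
      refine ⟨Nat.find hex, hs.1, ?_, hs.2.1⟩
      rw [hwin _ hs.1, hs.2.1]
      exact ⟨hs.2.2, fun i hi hiv => hmin i ⟨hi, hiv, hs.2.2⟩⟩
    · intro v
      by_cases hv : G.dist s v = t + 1
      · rw [hnew v ((hnext v).2 hv), levelDelta_of_le hv.le, hv]
      · rw [hold v (fun hcon => hv ((hnext v).1 hcon)), h.delta]
        by_cases hle : G.dist s v ≤ t
        · rw [levelDelta_of_le hle, levelDelta_of_le (by omega)]
        · rw [levelDelta_of_lt (by omega), levelDelta_of_lt (by omega)]
  · rw [hne, lt_levelCount_iff hG]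
    constructor
    · rintro ⟨j, hj, hlt⟩
      obtain ⟨x, u, -, -, hju⟩ := hc₁ j hj
      rw [hju] at hlt
      exact ⟨u, (hnext u).1 ⟨j, hj, hju, hlt⟩⟩
    · rintro ⟨v, hv⟩
      obtain ⟨j, hj, hjv, hlt⟩ := (hnext v).2 hv
      exact ⟨j, hj, by rwa [hjv]⟩
  · rw [g₄ _ (by decide)]

/-- The round distance (distance array `2`) is less than the level. -/
def roundOver : NumExpr := .dstLt (.get 2 (.const 0)) (.ofNum (.var 7))

theorem eval_roundOver (σ : State) (t : ℕ) (ht : σ.num 7 0 = t) (q : ℕ) :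
    roundOver.eval σ q = if σ.dst 2 0 < t then 1 else 0 := by
  simp [roundOver, NumExpr.eval, DstExpr.eval, ht]

theorem cost_roundOver : roundOver.cost = 6 := by
  simp [roundOver, NumExpr.cost, DstExpr.cost]

/-- Computes the next round distance if the present round is over. -/
def newRound : Program :=
  .ite roundOver
    (.setDst (.var 3) (.get 5 .pid) 2 (.const 0) (.add (.get 1 cand) (.get 0 cand))) .skip

/-- All marked candidates write δ + r to one cell, so priority-write computes the minimum in
constant depth. The level must be nonempty for a write to happen. -/
theorem exec_newRound (hG : G.Connected) (hin : IsInput G s r σ₀) {t K : ℕ} {σ : State}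
    (h : Level G s σ₀ t K σ) (ht : t < levelCount G s) :
    ∃ σ' W D, Exec newRound σ σ' [] W D ∧ W ≤ 100 * (K + 1) ∧ D ≤ 100 ∧
      Level G s σ₀ t K σ' ∧
      (σ.dst 2 0 < t → σ'.dst 2 0 = roundDist r {v | G.dist s v < t} (levelDelta G s t)) ∧
      (t ≤ σ.dst 2 0 → σ'.dst 2 0 = σ.dst 2 0) := by
  by_cases hd : σ.dst 2 0 < t
  · obtain ⟨σ', e, v, f, g⟩ := exec_setDst σ (.var 3) (.get 5 .pid) 2 (.const 0)
      (.add (.get 1 cand) (.get 0 cand))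
    simp only [NumExpr.eval, DstExpr.eval, NumExpr.eval_var, eval_cand, h.size] at v e
    refine ⟨σ', _, _, .iteTrue ?_ e, ?_, ?_, h.congr g (f _ (by decide)) (f _ (by decide)), ?_,
      fun hcon => absurd hd (not_lt.2 hcon)⟩
    · rw [eval_roundOver σ t h.level, if_pos hd]
      decide
    · simp only [NumExpr.cost, DstExpr.cost, NumExpr.cost_var, cost_cand, cost_roundOver]
      omega
    · simp only [NumExpr.cost, DstExpr.cost, NumExpr.cost_var, cost_cand, cost_roundOver]
      omega
    · intro _
      rw [v, roundDist_levelDelta]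
      unfold priorityWrite
      have hval : ∀ v : Fin n, σ.dst 1 v + σ.dst 0 v = levelDelta G s t v + r v := fun v => by
        rw [h.delta, h.radius, hin.radii]
      rw [if_pos]
      · apply le_antisymm
        · refine le_iInf₂ fun v hv => ?_
          obtain ⟨j, hj, hwj, hjv⟩ := h.cover v hv
          exact sInf_le ⟨j, hj, hwj, rfl, by beta_reduce; rw [hjv, hval]⟩
        · refine le_sInf ?_
          rintro y ⟨j, hj, hwj, -, rfl⟩
          obtain ⟨v, hv, hjv⟩ := h.mem j hj hwj
          beta_reduce
          rw [hjv, hval]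
          exact iInf₂_le v hv
      · obtain ⟨v, hv⟩ := (lt_levelCount_iff hG s t).1 ht
        obtain ⟨j, hj, hwj, -⟩ := h.cover v hv
        exact ⟨j, hj, hwj, rfl⟩
  · refine ⟨σ, _, _, .iteFalse ?_ (.skip σ), ?_, ?_, h, fun hcon => absurd hcon hd, fun _ => rfl⟩
    · rw [eval_roundOver σ t h.level, if_neg hd]
    · rw [cost_roundOver]; omega
    · rw [cost_roundOver]; omega

/-- Marks the end of a step: the round is over or the level is empty. -/
def endRound : Program := .ite (.add roundOver (.lt (.var 8) (.const 1))) .mark .skip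

/-- Treats one level. -/
def advance : Program := .seq newRound (.seq expand endRound)

/-- The loop over the levels. -/
def levelLoop : Program := .loop (.var 8) advance

theorem exec_endRound_mark (σ : State) {t : ℕ} (ht : σ.num 7 0 = t)
    (h : σ.dst 2 0 < t ∨ σ.num 8 0 = 0) : Exec endRound σ σ [σ] 12 12 := by
  refine (Exec.iteTrue ?_ (.mark σ)).cast ?_ ?_
  · simp only [NumExpr.eval, NumExpr.eval_var, eval_roundOver σ t ht]
    rcases h with h | h
    · simp [h]
    · simp [h]
  · simp [NumExpr.cost, cost_roundOver]
  · simp [NumExpr.cost, cost_roundOver]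

theorem exec_endRound_skip (σ : State) {t : ℕ} (ht : σ.num 7 0 = t)
    (h : ¬ (σ.dst 2 0 < t ∨ σ.num 8 0 = 0)) : Exec endRound σ σ [] 12 12 := by
  push Not at h
  refine (Exec.iteFalse ?_ (.skip σ)).cast ?_ ?_
  · simp only [NumExpr.eval, NumExpr.eval_var, eval_roundOver σ t ht, if_neg (not_lt.2 h.1)]
    rw [if_neg (by omega)]
  · simp [NumExpr.cost, cost_roundOver]
  · simp [NumExpr.cost, cost_roundOver]

/-- Induction on the number of remaining levels, with two claims about the trace. Between steps, it
is the rest of the run. Inside a step, its first entry closes that step, whose visited set was fixed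
at an earlier level; hence the arbitrary t₀ ≤ t + 1. -/
theorem exec_levelLoop (hG : G.Connected) {w : Sym2 (Fin n) → ℝ≥0}
    (hw : ∀ e ∈ G.edgeSet, w e = 1) (hin : IsInput G s r σ₀) (d : ℕ) :
    ∀ (t : ℕ) (σ : State), t + 1 + d = levelCount G s →
      Level G s σ₀ (t + 1) (arcCount G s t) σ → (σ.num 8 0 ≠ 0 ↔ t + 1 < levelCount G s) →
      ∃ σ' tr W D, Exec levelLoop σ σ' tr W D ∧
        W ≤ 3000 * ∑ i ∈ Finset.range d, (arcCount G s (t + i) + arcCount G s (t + 1 + i) + 1)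
          + 3 ∧
        D ≤ 3000 * ∑ i ∈ Finset.range d,
          (Nat.log 2 (arcCount G s (t + i)) + Nat.log 2 (arcCount G s (t + 1 + i)) + 1) + 3 ∧
        (∀ v : Fin n, σ'.dst 1 v = G.dist s v) ∧
        (σ.dst 2 0 < (t + 1 : ℕ) ∨ t + 1 = levelCount G s →
          Steps G w r (levelDelta G s (t + 1)) {v | G.dist s v < t + 1}
            (tr.map fun τ => (τ.round, τ.delta n))) ∧
        (∀ t₀ ≤ t + 1, ((t + 1 : ℕ) : ℝ≥0∞) ≤ σ.dst 2 0 → t + 1 < levelCount G s →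
          ∃ δ' tl, tr.map (fun τ => (τ.round, τ.delta n)) = (σ.dst 2 0, δ') :: tl ∧
            Substeps G w {v | G.dist s v < t₀} (σ.dst 2 0) (levelDelta G s (t + 1)) δ' ∧
            Steps G w r δ' {v | δ' v ≤ σ.dst 2 0} tl) := by
  induction d with
  | zero =>
    intro t σ ht h hne
    have ht' : t + 1 = levelCount G s := ht
    refine ⟨σ, [], _, _, .loopFalse ?_, ?_, ?_, ?_, ?_, ?_⟩
    · rw [NumExpr.eval_var]
      by_contra hcon
      exact absurd (hne.1 hcon) (by omega)
    · simp
    · simp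
    · intro v
      have := dist_lt_levelCount (G := G) s v
      rw [h.delta, levelDelta_of_le (by omega)]
    · intro _
      have huniv : {v | G.dist s v < t + 1} = Set.univ := by
        refine Set.eq_univ_of_forall fun v => ?_
        rw [ht']
        exact dist_lt_levelCount s v
      rw [huniv]
      exact .done _
    · intro _ _ _ hcon
      omega
  | succ d ih =>
    intro t σ ht h hne
    have htL : t + 1 < levelCount G s := by omega
    obtain ⟨σ₁, W₁, D₁, e₁, hW₁, hD₁, hl₁, hnew, hold⟩ := exec_newRound hG hin h htL
    obtain ⟨σ₂, W₂, D₂, e₂, hW₂, hD₂, hl₂, hne₂, hd₂⟩ := exec_expand hG hin hl₁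
    have hround : ((t + 1 : ℕ) : ℝ≥0∞) ≤ σ₁.dst 2 0 := by
      by_cases hlt : σ.dst 2 0 < (t + 1 : ℕ)
      · rw [hnew hlt]
        exact le_roundDist_levelDelta r s (t + 1)
      · rw [hold (not_lt.1 hlt)]
        exact not_lt.1 hlt
    obtain ⟨σ', tr, W₃, D₃, e₃, hW₃, hD₃, hfin, hsteps, hsub⟩ := ih (t + 1) σ₂ (by omega) hl₂ hne₂
    have hpre : σ.num 8 0 ≠ 0 := hne.2 htL
    have hsumW : ∑ i ∈ Finset.range (d + 1),
        (arcCount G s (t + i) + arcCount G s (t + 1 + i) + 1) =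
        ∑ i ∈ Finset.range d, (arcCount G s (t + 1 + i) + arcCount G s (t + 1 + 1 + i) + 1) +
          (arcCount G s t + arcCount G s (t + 1) + 1) := by
      rw [Finset.sum_range_succ']
      simp only [Nat.add_zero, add_assoc, add_comm 1]
    have hsumD : ∑ i ∈ Finset.range (d + 1),
        (Nat.log 2 (arcCount G s (t + i)) + Nat.log 2 (arcCount G s (t + 1 + i)) + 1) =
        ∑ i ∈ Finset.range d,
          (Nat.log 2 (arcCount G s (t + 1 + i)) + Nat.log 2 (arcCount G s (t + 1 + 1 + i)) + 1) +
          (Nat.log 2 (arcCount G s t) + Nat.log 2 (arcCount G s (t + 1)) + 1) := by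
      rw [Finset.sum_range_succ']
      simp only [Nat.add_zero, add_assoc, add_comm 1]
    rw [hsumW, hsumD]
    -- Once the round distance is settled, a step that starts here and one that continues differ
    -- only in t₀.
    have hcore : ∃ tr₁, Exec advance σ σ₂ tr₁ (W₁ + (W₂ + 12)) (D₁ + (D₂ + 12)) ∧
        ∀ t₀ ≤ t + 1, ∃ δ' tl, (tr₁ ++ tr).map (fun τ => (τ.round, τ.delta n)) =
          (σ₁.dst 2 0, δ') :: tl ∧
          Substeps G w {v | G.dist s v < t₀} (σ₁.dst 2 0) (levelDelta G s (t + 1)) δ' ∧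
          Steps G w r δ' {v | δ' v ≤ σ₁.dst 2 0} tl := by
      by_cases hend : σ₂.dst 2 0 < (t + 1 + 1 : ℕ) ∨ σ₂.num 8 0 = 0
      · refine ⟨_, .seq e₁ (.seq e₂ (exec_endRound_mark σ₂ hl₂.level hend)), fun t₀ ht₀ => ?_⟩
        have hend' : σ₂.dst 2 0 < (t + 1 + 1 : ℕ) ∨ levelCount G s ≤ t + 1 + 1 :=
          hend.imp_right fun h0 => by
            by_contra hcon
            exact hne₂.2 (by omega) h0
        have hdelta : σ₂.delta n = levelDelta G s (t + 1 + 1) := funext hl₂.delta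
        rw [hd₂] at hend'
        refine ⟨levelDelta G s (t + 1 + 1), tr.map fun τ => (τ.round, τ.delta n), ?_,
          substeps_last hG hw s ht₀ hround hend', ?_⟩
        · simp [State.round, hdelta, hd₂]
        · rw [setOf_levelDelta_succ_le s hround hend']
          refine hsteps ?_
          rw [hd₂]
          exact hend'.imp_right fun h0 => by omega
      · refine ⟨_, .seq e₁ (.seq e₂ (exec_endRound_skip σ₂ hl₂.level hend)), fun t₀ ht₀ => ?_⟩
        push Not at hend
        rw [hd₂] at hend hsub
        have hL := hne₂.1 hend.2
        obtain ⟨δ', tl, h1, h2, h3⟩ := hsub t₀ (by omega) hend.1 hL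
        exact ⟨δ', tl, h1, substeps_again hG hw s ht₀ hend.1 hL h2, h3⟩
    obtain ⟨tr₁, e₄, hcore⟩ := hcore
    refine ⟨σ', _, _, _, .loopTrue (by rwa [NumExpr.eval_var]) e₄ e₃, ?_, ?_, hfin, ?_, ?_⟩
    · rw [NumExpr.cost_var]
      omega
    · rw [NumExpr.cost_var]
      omega
    · intro hlt
      have hlt' : σ.dst 2 0 < (t + 1 : ℕ) := hlt.resolve_right (by omega)
      -- A step that starts here has visited everything below the present level.
      obtain ⟨δ', tl, h1, h2, h3⟩ := hcore (t + 1) le_rfl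
      rw [h1]
      rw [hnew hlt'] at h2 h3 ⊢
      refine .step _ _ _ _ ?_ h2 h3
      obtain ⟨v, hv⟩ := (lt_levelCount_iff hG s _).1 htL
      intro hcon
      have : v ∈ {v | G.dist s v < t + 1} := hcon ▸ Set.mem_univ v
      have : G.dist s v < t + 1 := this
      omega
    · intro t₀ ht₀ hle _
      rw [← hold hle]
      exact hcore t₀ ht₀

end PRAM

namespace PRAM

-- Initialisation and the complete program

open RadiusStepping

variable {n : ℕ} {G : SimpleGraph (Fin n)} {s : Fin n} {r : Fin n → ℝ≥0∞}

/-- Sets up the description of level `0`. -/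
def prepare : Program :=
  .seq (.setDst (.var 0) (.const 1) 1 .pid .inf)
    (.seq (.setDst (.const 1) (.const 1) 1 (.get 0 (.const 1)) (.ofNum (.const 0)))
      (.seq (assign 3 (.const 1))
        (.seq (assign 4 (.get 0 (.const 1))) (assign 5 (.const 1)))))

theorem exec_prepare (hG : G.Connected) {σ : State} (hin : IsInput G s r σ) :
    ∃ σ' W D, Exec prepare σ σ' [] W D ∧ W ≤ 100 * (n + 1) ∧ D ≤ 100 ∧
      Level G s σ 0 1 σ' ∧ σ'.dst 2 0 = 0 := by
  obtain ⟨σ₁, e₁, v₁, f₁, g₁⟩ := exec_setDst σ (.var 0) (.const 1) 1 .pid .inf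
  simp only [NumExpr.eval, DstExpr.eval, NumExpr.eval_var, hin.size] at v₁ e₁
  obtain ⟨σ₂, e₂, v₂, f₂, g₂⟩ := exec_setDst σ₁ (.const 1) (.const 1) 1 (.get 0 (.const 1))
    (.ofNum (.const 0))
  simp only [NumExpr.eval, DstExpr.eval, g₁, hin.source] at v₂ e₂
  obtain ⟨σ₃, e₃, v₃, f₃, g₃⟩ := exec_assign σ₂ 3 (.const 1)
  obtain ⟨σ₄, e₄, v₄, f₄, g₄⟩ := exec_assign σ₃ 4 (.get 0 (.const 1))
  simp only [NumExpr.eval, f₃ 0 (by decide), g₂, g₁, hin.source] at v₄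
  obtain ⟨σ₅, e₅, v₅, f₅, g₅⟩ := exec_assign σ₄ 5 (.const 1)
  have hnum : ∀ b, b ≠ 3 → b ≠ 4 → b ≠ 5 → σ₅.num b = σ.num b := fun b h3 h4 h5 => by
    rw [f₅ b h5, f₄ b h4, f₃ b h3, g₂, g₁]
  have hdst : σ₅.dst = σ₂.dst := by rw [g₅, g₄, g₃]
  have h5 : σ₅.num 5 0 ≠ 0 := by rw [v₅]; simp [NumExpr.eval]
  have h4 : σ₅.num 4 0 = s := by rw [f₅ _ (by decide), v₄]
  refine ⟨σ₅, _, _, e₁.seq_nil (e₂.seq_nil (e₃.seq_nil (e₄.seq_nil e₅))), ?_, ?_,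
    ⟨hnum _ (by decide) (by decide) (by decide), hnum _ (by decide) (by decide) (by decide), ?_,
      ?_, ?_, ?_, ?_, ?_, ?_⟩, ?_⟩
  · simp only [NumExpr.cost, DstExpr.cost, NumExpr.cost_var]
    omega
  · simp only [NumExpr.cost, DstExpr.cost, NumExpr.cost_var]
    omega
  · rw [hdst, f₂ _ (by decide), f₁ _ (by decide)]
  · rw [f₅ _ (by decide), f₄ _ (by decide), v₃]
    simp [NumExpr.eval]
  · rw [hnum _ (by decide) (by decide) (by decide), hin.num_rest _ _ (by decide)]
  · intro i hi j hj _ _ _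
    omega
  · intro j hj _
    obtain rfl : j = 0 := by omega
    exact ⟨s, by simp, h4⟩
  · intro v hv
    obtain rfl : s = v := hG.dist_eq_zero_iff.1 hv
    exact ⟨0, by decide, h5, h4⟩
  · intro v
    rw [hdst, v₂]
    by_cases hv : s = v
    · subst hv
      rw [levelDelta_of_le (by simp), SimpleGraph.dist_self]
      exact priorityWrite_of_forall_eq (x := fun _ => ((0 : ℕ) : ℝ≥0∞)) (q := 0) (by decide)
        (by decide) rfl fun _ _ _ _ => rfl
    · have h0 : 0 < G.dist s v := hG.pos_dist_of_ne hv
      rw [levelDelta_of_lt h0,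
        priorityWrite_of_forall_ne (fun _ _ _ hcon => hv (Fin.ext hcon)), v₁]
      exact priorityWrite_of_forall_eq (x := fun _ => (∞ : ℝ≥0∞)) (q := v) v.isLt (by decide) rfl
        fun _ _ _ _ => rfl
  · rw [hdst, f₂ _ (by decide), f₁ _ (by decide), hin.dst_rest _ _ (by decide)]

/-- Radius Stepping on unweighted graphs. -/
def radiusStepping : Program := .seq prepare (.seq expand levelLoop)

theorem exec_radiusStepping (hG : G.Connected) {w : Sym2 (Fin n) → ℝ≥0}
    (hw : ∀ e ∈ G.edgeSet, w e = 1) {σ : State} (hin : IsInput G s r σ) :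
    ∃ σ' tr W D, Exec radiusStepping σ σ' tr W D ∧
      IsRun G w r s (tr.map fun τ => (τ.round, τ.delta n)) ∧
      (∀ v, σ'.delta n v = wdist G w s v) ∧
      W ≤ 20000 * (G.edgeSet.ncard + n) ∧
      D ≤ 10000 * ∑ i ∈ Finset.range (levelCount G s), (Nat.log 2 (arcCount G s i) + 1) := by
  obtain ⟨σ₁, W₁, D₁, e₁, hW₁, hD₁, hl₁, hd₁⟩ := exec_prepare hG hin
  obtain ⟨σ₂, W₂, D₂, e₂, hW₂, hD₂, hl₂, hne, hd₂⟩ := exec_expand hG hin hl₁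
  obtain ⟨d, hd⟩ : ∃ d, levelCount G s = d + 1 := ⟨_, rfl⟩
  obtain ⟨σ', tr, W₃, D₃, e₃, hW₃, hD₃, hfin, hsteps, -⟩ :=
    exec_levelLoop hG hw hin d 0 σ₂ (by omega) hl₂ hne
  refine ⟨σ', tr, _, _, .seq e₁ (.seq e₂ e₃), ?_, fun v => ?_, ?_, ?_⟩
  · unfold IsRun
    rw [initDelta_eq_levelDelta hG hw]
    have hs : ({s} : Set (Fin n)) = {v | G.dist s v < 0 + 1} := by
      ext v
      change v = s ↔ G.dist s v < 0 + 1
      rw [Nat.lt_one_iff, hG.dist_eq_zero_iff]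
      exact eq_comm
    rw [hs]
    -- The round cell still holds its initial 0, which is below level 1, so the loop opens a fresh
    -- step.
    refine hsteps (.inl ?_)
    rw [hd₂, hd₁]
    simp
  · rw [wdist_eq_dist hG hw]
    exact hfin v
  · have hsum := sum_range_arcCount (G := G) s
    have hn := levelCount_le_card hG s
    rw [Fintype.card_fin] at hn
    -- The loop bound contains the arc counts twice, once shifted by a level; each sum is at most
    -- the full sum 2m.
    have h1 := Finset.sum_range_succ' (arcCount G s) d
    have h2 := Finset.sum_range_succ (arcCount G s) d
    rw [hd] at hsum hn
    simp only [Finset.sum_add_distrib, Finset.sum_const, Finset.card_range, smul_eq_mul, mul_one,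
      zero_add, add_comm 1] at hW₃
    omega
  · have h1 := Finset.sum_range_succ' (fun i => Nat.log 2 (arcCount G s i)) d
    have h2 := Finset.sum_range_succ (fun i => Nat.log 2 (arcCount G s i)) d
    rw [hd]
    simp only [Finset.sum_add_distrib, Finset.sum_const, Finset.card_range, smul_eq_mul, mul_one,
      zero_add, add_comm 1, Nat.log_one_right] at hD₂ hD₃ ⊢
    omega

end PRAM

namespace RadiusStepping

-- Summing the depth over the levels

theorem sum_log_arcCount_le {V : Type*} [Fintype V] {G : SimpleGraph V} (hG : G.Connected) (s : V)
    {k ρ : ℕ} (hk : 1 ≤ k) (hρ : 2 ≤ ρ) (h : ∀ v, ρ ≤ {x | G.dist v x ≤ k + 1}.ncard) :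
    ((∑ i ∈ Finset.range (levelCount G s), (Nat.log 2 (arcCount G s i) + 1) : ℕ) : ℝ) ≤
      27 * (k * ((Fintype.card V : ℝ) / ρ) * Real.logb 2 ρ) := by
  have hρ0 : (0 : ℝ) < ρ := by positivity
  have hk' : (1 : ℝ) ≤ k := by exact_mod_cast hk
  have hlog : 1 ≤ Real.logb 2 ρ := by
    rw [Real.le_logb_iff_rpow_le one_lt_two hρ0, Real.rpow_one]
    exact_mod_cast hρ
  have hL : (levelCount G s : ℝ) ≤ 5 * (k * ((Fintype.card V : ℝ) / ρ)) := by
    have h1 := levelCount_mul_le hG s h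
    -- The radius is R = k + 1, and 2(k + 1) + 1 ≤ 5k because k ≥ 1.
    have h2 : levelCount G s * ρ ≤ 5 * k * Fintype.card V :=
      h1.trans (Nat.mul_le_mul_right _ (by omega))
    have h3 : (levelCount G s : ℝ) * ρ ≤ 5 * k * Fintype.card V := by exact_mod_cast h2
    calc (levelCount G s : ℝ) ≤ 5 * k * Fintype.card V / ρ := (le_div_iff₀ hρ0).2 h3
      _ = 5 * (k * ((Fintype.card V : ℝ) / ρ)) := by ring
  have hnear : (∑ i ∈ Finset.range (levelCount G s), (nearCount G s i : ℝ)) ≤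
      3 * Fintype.card V := by
    exact_mod_cast sum_range_nearCount_le s (levelCount G s)
  have hsum : ∑ i ∈ Finset.range (levelCount G s), ((Nat.log 2 (arcCount G s i) : ℝ) + 1) ≤
      ∑ i ∈ Finset.range (levelCount G s),
        (2 * Real.logb 2 ρ + 4 * (nearCount G s i / ρ) + 1) := by
    refine Finset.sum_le_sum fun i _ => ?_
    have := log_arcCount_le hG s i (ρ := ρ) (by omega)
    linarith
  have hsum' : ∑ i ∈ Finset.range (levelCount G s),
        (2 * Real.logb 2 ρ + 4 * (nearCount G s i / ρ) + 1) =
      levelCount G s * (2 * Real.logb 2 ρ + 1) +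
        4 * ((∑ i ∈ Finset.range (levelCount G s), (nearCount G s i : ℝ)) / ρ) := by
    rw [Finset.sum_div, Finset.mul_sum, Finset.sum_add_distrib, Finset.sum_add_distrib]
    simp only [Finset.sum_const, Finset.card_range, nsmul_eq_mul]
    ring
  have hq : (∑ i ∈ Finset.range (levelCount G s), (nearCount G s i : ℝ)) / ρ ≤
      3 * ((Fintype.card V : ℝ) / ρ) := by
    rw [← mul_div_assoc]
    exact div_le_div_of_nonneg_right hnear hρ0.le
  push_cast
  refine hsum.trans ?_
  rw [hsum']
  set q := (Fintype.card V : ℝ) / ρ with hqdef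
  have hq0 : 0 ≤ q := by positivity
  have hkq : q ≤ k * q := le_mul_of_one_le_left hq0 hk'
  have hkql : k * q ≤ k * q * Real.logb 2 ρ := le_mul_of_one_le_right (by positivity) hlog
  -- The constant is 27 = 10 + 5 + 12: the levels contribute 5(2 log ρ + 1), the nearby vertices 4 ·
  -- 3, with 1 ≤ log ρ and 1 ≤ k absorbing the rest.
  have h1 : (levelCount G s : ℝ) * (2 * Real.logb 2 ρ + 1) ≤
      5 * (k * q) * (2 * Real.logb 2 ρ + 1) :=
    mul_le_mul_of_nonneg_right hL (by positivity)
  nlinarith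

end RadiusStepping

theorem mainTheorem7 :
    ∃ (P : PRAM.Program) (C : ℕ),
      ∀ (n : ℕ) (G : SimpleGraph (Fin n)) (w : Sym2 (Fin n) → ℝ≥0) (r : Fin n → ℝ≥0∞)
        (src : Fin n) (k ρ : ℕ),
        G.Connected →
        (∀ e ∈ G.edgeSet, w e = 1) →
        1 ≤ k →
        2 ≤ ρ →
        (∀ v, r v ≤ RadiusStepping.kRadius G w k v) →
        (∀ v, ρ ≤ (RadiusStepping.ball G w v (r v)).ncard) →
        ∀ σ : PRAM.State, PRAM.IsInput G src r σ →
          ∃ (σ' : PRAM.State) (tr : List PRAM.State) (W D : ℕ),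
            PRAM.Exec P σ σ' tr W D ∧
            RadiusStepping.IsRun G w r src (tr.map fun τ => (τ.round, τ.delta n)) ∧
            (∀ v, σ'.delta n v = RadiusStepping.wdist G w src v) ∧
            W ≤ C * (G.edgeSet.ncard + n) ∧
            (D : ℝ) ≤ C * (k * ((n : ℝ) / ρ) * Real.logb 2 ρ * logStar ρ) := by
  -- The depth dictates 270000 = 10000 · 27; the work needs only 20000.
  refine ⟨PRAM.radiusStepping, 270000, ?_⟩
  intro n G w r src k ρ hG hw hk hρ hr hball σ hin
  obtain ⟨σ', tr, W, D, he, hrun, hfin, hW, hD⟩ := PRAM.exec_radiusStepping hG hw hin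
  refine ⟨σ', tr, W, D, he, hrun, hfin, hW.trans (Nat.mul_le_mul_right _ (by decide)), ?_⟩
  have hsum := RadiusStepping.sum_log_arcCount_le hG src hk hρ fun v =>
    (hball v).trans (Set.ncard_le_ncard
      (fun x hx => RadiusStepping.dist_le_of_mem_ball hG hw (hr v) hx) (Set.toFinite _))
  rw [Fintype.card_fin] at hsum
  have hD' : (D : ℝ) ≤ 10000 * ((∑ i ∈ Finset.range (RadiusStepping.levelCount G src),
      (Nat.log 2 (RadiusStepping.arcCount G src i) + 1) : ℕ) : ℝ) := by exact_mod_cast hD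
  have hlog : 0 ≤ Real.logb 2 ρ :=
    Real.logb_nonneg one_lt_two (by exact_mod_cast (by omega : 1 ≤ ρ))
  have hstar : (1 : ℝ) ≤ logStar ρ := by exact_mod_cast RadiusStepping.logStar_pos hρ
  have hnonneg : 0 ≤ k * ((n : ℝ) / ρ) * Real.logb 2 ρ := by positivity
  have := le_mul_of_one_le_right hnonneg hstar
  push_cast at hD' hsum ⊢
  linarith
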